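/- **Proposition.** Let $\Omega\subset\mathbb R^2$ be a nonempty Lipschitz open set of finite area, that is, near each of its boundary points $\Omega$ is, in suitable Cartesian coordinates, the region strictly above the graph of a Lipschitz function of one variable. For $k\in\{1,2\}$ let $H^k_0(\Omega)$ be the closure of $C_c^\infty(\Omega)$ in the Sobolev space $H^k(\Omega)$, and define the first buckling eigenvalue and the first Stokes eigenvalue of $\Omega$ by $$\lambda_1^B(\Omega)=\inf\left\{\frac{\int_\Omega(\Delta\psi)^2\,dx}{\int_\Omega|\nabla\psi|^2\,dx}\;:\;\psi\in H^2_0(\Omega),\ \int_\Omega|\nabla\psi|^2\,dx\neq0\right\},$$ $$\lambda_1^S(\Omega)=\inf\left\{\frac{\int_\Omega|\nabla u|^2\,dx}{\int_\Omega|u|^2\,dx}\;:\;u\in H^1_0(\Omega;\mathbb R^2),\ \nabla\cdot u=0\text{ in }\Omega,\ \int_\Omega|u|^2\,dx\neq0\right\}.$$ Then $\lambda_1^B(\Omega)\ge\lambda_1^S(\Omega)$. If moreover $\Omega$ is simply connected, then $\lambda_1^B(\Omega)=\lambda_1^S(\Omega)$. -/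

import Mathlib

open MeasureTheory Set
open scoped ENNReal ContDiff NNReal

noncomputable section

namespace BucklingStokes

/-- The Euclidean plane. -/
abbrev Plane : Type := EuclideanSpace ℝ (Fin 2)

/-- `Ω` is a Lipschitz open set: near each boundary point, in suitable Cartesian coordinates,
`Ω` is the region strictly above the graph of a Lipschitz function of one variable. -/
def IsLipschitzOpen (Ω : Set Plane) : Prop :=
  IsOpen Ω ∧ ∀ p ∈ frontier Ω, ∃ (U : Set Plane) (T : Plane ≃ₗᵢ[ℝ] Plane) (K : ℝ≥0) (g : ℝ → ℝ),
    IsOpen U ∧ p ∈ U ∧ LipschitzWith K g ∧ ∀ x ∈ U, (x ∈ Ω ↔ g (T x 0) < T x 1)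

/-- Test functions: the elements of `C_c^∞(Ω)`, as functions on the whole plane. -/
def IsTest (Ω : Set Plane) (φ : Plane → ℝ) : Prop :=
  ContDiff ℝ ∞ φ ∧ HasCompactSupport φ ∧ tsupport φ ⊆ Ω

/-- The classical partial derivative of `φ` in the `i`-th coordinate. -/
def partialDeriv (i : Fin 2) (φ : Plane → ℝ) (x : Plane) : ℝ :=
  fderiv ℝ φ x (EuclideanSpace.single i 1)

/-- `g` is a weak `i`-th partial derivative of `f` in `Ω`. -/
def HasWeakPartial (Ω : Set Plane) (i : Fin 2) (f g : Plane → ℝ) : Prop :=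
  LocallyIntegrableOn f Ω ∧ LocallyIntegrableOn g Ω ∧
    ∀ φ, IsTest Ω φ → ∫ x in Ω, f x * partialDeriv i φ x = -∫ x in Ω, g x * φ x

open Classical in
/-- The weak `i`-th partial derivative of `f` in `Ω` (unique up to null sets in `Ω`), when it
exists. -/
def weakPartial (Ω : Set Plane) (i : Fin 2) (f : Plane → ℝ) : Plane → ℝ :=
  if h : ∃ g, HasWeakPartial Ω i f g then h.choose else 0

/-- Membership in `H^k(Ω)`: all weak derivatives of order at most `k` exist and belong
to `L²(Ω)`. -/
def MemH (Ω : Set Plane) : ℕ → (Plane → ℝ) → Prop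
  | 0, f => MemLp f 2 (volume.restrict Ω)
  | k + 1, f => MemLp f 2 (volume.restrict Ω) ∧
      ∀ i, (∃ g, HasWeakPartial Ω i f g) ∧ MemH Ω k (weakPartial Ω i f)

/-- The squared `H^k(Ω)` norm (for `f` in `H^k(Ω)`): the sum of the squared `L²(Ω)` norms of all
partial derivatives `∂_{i₁} ⋯ ∂_{iₘ} f` with `m ≤ k`. -/
def normSqH (Ω : Set Plane) : ℕ → (Plane → ℝ) → ℝ≥0∞
  | 0, f => eLpNorm f 2 (volume.restrict Ω) ^ 2
  | k + 1, f => eLpNorm f 2 (volume.restrict Ω) ^ 2 + ∑ i, normSqH Ω k (weakPartial Ω i f)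

/-- Membership in `H^k_0(Ω)`, the closure of `C_c^∞(Ω)` in `H^k(Ω)`. -/
def MemH0 (Ω : Set Plane) (k : ℕ) (f : Plane → ℝ) : Prop :=
  MemH Ω k f ∧ ∀ ε : ℝ≥0∞, 0 < ε → ∃ φ, IsTest Ω φ ∧ normSqH Ω k (f - φ) < ε

/-- `Δψ = ∂₁∂₁ψ + ∂₂∂₂ψ`, in the weak sense. -/
def weakLaplacian (Ω : Set Plane) (ψ : Plane → ℝ) (x : Plane) : ℝ :=
  ∑ i, weakPartial Ω i (weakPartial Ω i ψ) x

/-- `∫_Ω (Δψ)² dx`. -/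
def bendingEnergy (Ω : Set Plane) (ψ : Plane → ℝ) : ℝ :=
  ∫ x in Ω, weakLaplacian Ω ψ x ^ 2

/-- `∫_Ω |∇ψ|² dx` for a scalar function `ψ`. -/
def dirichletEnergy (Ω : Set Plane) (ψ : Plane → ℝ) : ℝ :=
  ∫ x in Ω, ∑ i, weakPartial Ω i ψ x ^ 2

/-- Membership in `H^1_0(Ω; ℝ²)`. -/
def MemH10Vec (Ω : Set Plane) (u : Plane → Plane) : Prop :=
  ∀ j : Fin 2, MemH0 Ω 1 (fun x => u x j)

/-- `∇ · u = 0` in `Ω`, in the weak sense. -/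
def IsDivFree (Ω : Set Plane) (u : Plane → Plane) : Prop :=
  ∀ᵐ x ∂(volume.restrict Ω), ∑ i, weakPartial Ω i (fun y => u y i) x = 0

/-- `∫_Ω |∇u|² dx` for a vector field `u`. -/
def dirichletEnergyVec (Ω : Set Plane) (u : Plane → Plane) : ℝ :=
  ∫ x in Ω, ∑ i, ∑ j, weakPartial Ω i (fun y => u y j) x ^ 2

/-- `∫_Ω |u|² dx` for a vector field `u`. -/
def kineticEnergy (Ω : Set Plane) (u : Plane → Plane) : ℝ :=
  ∫ x in Ω, ‖u x‖ ^ 2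

/-- The first buckling eigenvalue `λ₁^B(Ω)`: the infimum of the Rayleigh quotient
`∫_Ω (Δψ)² / ∫_Ω |∇ψ|²` over the `ψ` in `H^2_0(Ω)` for which
it is defined. -/
def lambdaB (Ω : Set Plane) : ℝ :=
  sInf {q | ∃ ψ, MemH0 Ω 2 ψ ∧ dirichletEnergy Ω ψ ≠ 0 ∧
    q = bendingEnergy Ω ψ / dirichletEnergy Ω ψ}

/-- The first Stokes eigenvalue `λ₁^S(Ω)`: the infimum of the Rayleigh quotient
`∫_Ω |∇u|² / ∫_Ω |u|²` over the divergence-free `u` in `H^1_0(Ω; ℝ²)` for which it is defined. -/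
def lambdaS (Ω : Set Plane) : ℝ :=
  sInf {q | ∃ u, MemH10Vec Ω u ∧ IsDivFree Ω u ∧ kineticEnergy Ω u ≠ 0 ∧
    q = dirichletEnergyVec Ω u / kineticEnergy Ω u}

end BucklingStokes

end

/-!
# The first buckling eigenvalue and the first Stokes eigenvalue

The two Rayleigh quotients are exchanged by the perpendicular gradient `u = (∂₁ψ, -∂₀ψ)`
(coordinates are numbered `0` and `1`). If `ψ` is in `H²_0(Ω)`, then `u` is a divergence free
`H¹_0` field, `|u| = |∇ψ|`, and `∫ |∇u|² = ∫ |D²ψ|² = ∫ (Δψ)²` because the Hessian determinant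
of an `H²_0` function has integral zero (`MemH0.integral_hessian`). So every buckling quotient
is a Stokes quotient, which is the inequality.

For the equality, every divergence free `u` in `H¹_0(Ω; ℝ²)` must have a stream function in
`H²_0(Ω)`.

* `exists_stream_function`: approximate `u` in `H¹` by test fields `uₙ`, hence in `L¹` together
  with the first derivatives, as the area is finite. The vertical primitive of the first
  component of `uₙ` and minus the horizontal primitive of the second differ by at most
  `‖div uₙ‖_{L¹} → 0` (`enorm_primitive_add_primitive_le`), and both converge uniformly to one
  function `ψ`. It is continuous, it is a stream function of the extension of `u` by zero, it is
  locally constant off the closure of `Ω`, and it tends to zero at infinity, since far away one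
  of the two primitives of the compactly supported `uₙ` vanishes. That `Ω` may be unbounded
  causes no difficulty.
* `IsLipschitzOpen.eventually_eq_of_exterior`: as the boundary is Lipschitz, `ψ` is then locally
  constant on the whole complement of `Ω`.
* `eq_zero_of_locally_constant`: a nonzero level set of `ψ` in the complement would be compact
  and open in the complement. For a simply connected `Ω` there is no such set
  (`eq_empty_of_isCompact_of_compl`), as one sees from the logarithm of `x - p` for a point `p`
  of it. Hence `ψ` vanishes off `Ω`.
* `IsLipschitzOpen.memH0_of_eq_zero`: an `H^k` function on the plane which vanishes off a
  Lipschitz open set is in `H^k_0`. It is cut off at infinity, localized by a partition of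
  unity, and mollified with kernels supported in small balls displaced towards the interior of
  `Ω`.
-/

noncomputable section

namespace BucklingStokes

open Filter Topology
open scoped Convolution Pointwise

variable {Ω : Set Plane} {φ θ f g : Plane → ℝ} {i j : Fin 2}

/-! ### Test functions and partial derivatives -/

lemma partialDeriv_sub {φ θ : Plane → ℝ} (i : Fin 2) (hφ : Differentiable ℝ φ)
    (hθ : Differentiable ℝ θ) :
    partialDeriv i (φ - θ) = partialDeriv i φ - partialDeriv i θ := by
  funext x; simp [partialDeriv, fderiv_sub (hφ x) (hθ x)]

lemma partialDeriv_mul {φ θ : Plane → ℝ} (i : Fin 2) (hφ : Differentiable ℝ φ)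
    (hθ : Differentiable ℝ θ) :
    partialDeriv i (φ * θ) = partialDeriv i φ * θ + φ * partialDeriv i θ := by
  funext x
  simp [partialDeriv, fderiv_mul (hφ x) (hθ x)]
  ring

lemma contDiff_partialDeriv {φ : Plane → ℝ} (i : Fin 2) (hφ : ContDiff ℝ ∞ φ) :
    ContDiff ℝ ∞ (partialDeriv i φ) :=
  (hφ.fderiv_right (m := ∞) (by simp)).clm_apply contDiff_const

lemma continuous_partialDeriv {φ : Plane → ℝ} (i : Fin 2) (hφ : ContDiff ℝ ∞ φ) :
    Continuous (partialDeriv i φ) := (contDiff_partialDeriv i hφ).continuous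

lemma differentiable_of_contDiff {φ : Plane → ℝ} (hφ : ContDiff ℝ ∞ φ) : Differentiable ℝ φ :=
  hφ.differentiable (by simp)

lemma partialDeriv_comm {φ : Plane → ℝ} (hφ : ContDiff ℝ ∞ φ) (i j : Fin 2) :
    partialDeriv i (partialDeriv j φ) = partialDeriv j (partialDeriv i φ) := by
  funext x
  have hd : DifferentiableAt ℝ (fderiv ℝ φ) x :=
    ((hφ.fderiv_right (m := ∞) (by simp)).differentiable (by simp)) x
  have key : ∀ a b : Fin 2, partialDeriv a (partialDeriv b φ) x
      = fderiv ℝ (fderiv ℝ φ) x (EuclideanSpace.single a 1) (EuclideanSpace.single b 1) := by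
    intro a b
    unfold partialDeriv
    rw [fderiv_clm_apply hd (differentiableAt_const _)]
    simp
  rw [key, key]
  exact (hφ.contDiffAt.isSymmSndFDerivAt (by simp; exact WithTop.coe_le_coe.2 le_top)).eq _ _

lemma tsupport_partialDeriv_subset (i : Fin 2) (φ : Plane → ℝ) :
    tsupport (partialDeriv i φ) ⊆ tsupport φ :=
  (tsupport_fderiv_apply_subset ℝ _)

lemma IsTest.isTest_partialDeriv (h : IsTest Ω φ) (i : Fin 2) : IsTest Ω (partialDeriv i φ) :=
  ⟨contDiff_partialDeriv i h.1, h.2.1.fderiv_apply ℝ _,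
    (tsupport_partialDeriv_subset i φ).trans h.2.2⟩

lemma IsTest.mono {Ω' : Set Plane} (h : IsTest Ω φ) (hs : Ω ⊆ Ω') : IsTest Ω' φ :=
  ⟨h.1, h.2.1, h.2.2.trans hs⟩

lemma IsTest.differentiable (h : IsTest Ω φ) : Differentiable ℝ φ :=
  differentiable_of_contDiff h.1

lemma IsTest.continuous (h : IsTest Ω φ) : Continuous φ := h.1.continuous

lemma IsTest.neg (h : IsTest Ω φ) : IsTest Ω (-φ) :=
  ⟨h.1.neg, h.2.1.neg, by
    rw [show -φ = fun x => -φ x from rfl, tsupport, Function.support_fun_neg]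
    exact h.2.2⟩

lemma IsTest.add (h : IsTest Ω φ) (h' : IsTest Ω θ) : IsTest Ω (φ + θ) :=
  ⟨h.1.add h'.1, h.2.1.add h'.2.1,
    (tsupport_add φ θ).trans (union_subset h.2.2 h'.2.2)⟩

lemma IsTest.sub (h : IsTest Ω φ) (h' : IsTest Ω θ) : IsTest Ω (φ - θ) := by
  rw [sub_eq_add_neg]; exact h.add h'.neg

lemma isTest_zero : IsTest Ω (0 : Plane → ℝ) :=
  ⟨contDiff_const, HasCompactSupport.zero, by simp [tsupport]⟩

lemma IsTest.smooth_mul {χ : Plane → ℝ} (h : IsTest Ω φ) (hχ : ContDiff ℝ ∞ χ) :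
    IsTest Ω (χ * φ) :=
  ⟨hχ.mul h.1, h.2.1.mul_left, (tsupport_mul_subset_right).trans h.2.2⟩

lemma IsTest.eq_zero (h : IsTest Ω φ) {x : Plane} (hx : x ∉ Ω) : φ x = 0 :=
  image_eq_zero_of_notMem_tsupport fun hx' => hx (h.2.2 hx')

lemma IsTest.memLp (h : IsTest Ω φ) (p : ℝ≥0∞) (μ : Measure Plane) [IsFiniteMeasureOnCompacts μ] :
    MemLp φ p μ := h.continuous.memLp_of_hasCompactSupport h.2.1

lemma IsTest.integrable (h : IsTest Ω φ) : Integrable φ volume :=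
  h.continuous.integrable_of_hasCompactSupport h.2.1

/-- The integral over `Ω` of a function vanishing off `Ω` is the integral over the plane. -/
lemma IsTest.setIntegral_mul (h : IsTest Ω φ) (f : Plane → ℝ) :
    ∫ x in Ω, f x * φ x = ∫ x, f x * φ x :=
  setIntegral_eq_integral_of_forall_compl_eq_zero fun x hx => by simp [h.eq_zero hx]

lemma IsTest.integrable_mul (h : IsTest Ω φ) {f : Plane → ℝ}
    (hf : LocallyIntegrableOn f Ω) : Integrable (fun x => f x * φ x) := by
  have h1 : IntegrableOn f (tsupport φ) :=
    (hf.mono_set h.2.2).integrableOn_isCompact h.2.1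
  have h2 : IntegrableOn (fun x => f x * φ x) (tsupport φ) :=
    h1.mul_continuousOn h.continuous.continuousOn h.2.1
  refine (integrableOn_iff_integrable_of_support_subset ?_).1 h2
  intro x hx
  by_contra hx'
  exact hx (by simp [image_eq_zero_of_notMem_tsupport hx'])

/-! ### Weak derivatives -/

lemma locallyIntegrableOn_of_memLp {p : ℝ≥0∞} (hp : 1 ≤ p) (hf : MemLp f p (volume.restrict Ω)) :
    LocallyIntegrableOn f Ω := by
  have := (hf.locallyIntegrable hp)
  exact locallyIntegrableOn_of_locallyIntegrable_restrict this

lemma hasWeakPartial_iff : HasWeakPartial Ω i f g ↔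
    LocallyIntegrableOn f Ω ∧ LocallyIntegrableOn g Ω ∧
    ∀ φ, IsTest Ω φ → ∫ x, f x * partialDeriv i φ x = -∫ x, g x * φ x := by
  unfold HasWeakPartial
  refine and_congr_right fun _ => and_congr_right fun _ => forall_congr' fun φ =>
    forall_congr' fun hφ => ?_
  rw [(hφ.isTest_partialDeriv i).setIntegral_mul, hφ.setIntegral_mul]

lemma locallyIntegrableOn_congr (hf : LocallyIntegrableOn f Ω)
    (h : f =ᵐ[volume.restrict Ω] g) : LocallyIntegrableOn g Ω := by
  intro x hx
  obtain ⟨s, hs, hi⟩ := hf x hx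
  refine ⟨s ∩ Ω, Filter.inter_mem hs self_mem_nhdsWithin, ?_⟩
  have h1 : IntegrableOn f (s ∩ Ω) := hi.mono_set inter_subset_left
  exact h1.congr (ae_mono (Measure.restrict_mono inter_subset_right le_rfl) h)

lemma HasWeakPartial.congr (h : HasWeakPartial Ω i f g) (hf : f =ᵐ[volume.restrict Ω] f')
    (hg : g =ᵐ[volume.restrict Ω] g') : HasWeakPartial Ω i f' g' := by
  refine ⟨locallyIntegrableOn_congr h.1 hf, locallyIntegrableOn_congr h.2.1 hg, fun φ hφ => ?_⟩
  have := h.2.2 φ hφ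
  rw [integral_congr_ae (g := fun x => f' x * partialDeriv i φ x)
    (by filter_upwards [hf] with x hx; rw [hx]),
    integral_congr_ae (f := fun x => g x * φ x) (g := fun x => g' x * φ x)
    (by filter_upwards [hg] with x hx; rw [hx])] at this
  exact this

lemma HasWeakPartial.unique (hΩ : IsOpen Ω) (h : HasWeakPartial Ω i f g)
    (h' : HasWeakPartial Ω i f g') : g =ᵐ[volume.restrict Ω] g' := by
  have h1 := ((hasWeakPartial_iff).1 h)
  have h2 := ((hasWeakPartial_iff).1 h')
  have := hΩ.ae_eq_zero_of_integral_contDiff_smul_eq_zero (f := g - g') (μ := volume)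
    (h1.2.1.sub h2.2.1) (by
      intro φ a b c
      have hφ : IsTest Ω φ := ⟨a, b, c⟩
      have e := (h1.2.2 φ hφ).symm.trans (h2.2.2 φ hφ)
      have i1 := hφ.integrable_mul h1.2.1
      have i2 := hφ.integrable_mul h2.2.1
      have : ∀ x, φ x • (g - g') x = g x * φ x - g' x * φ x := fun x => by simp; ring
      simp_rw [this]
      rw [integral_sub i1 i2]
      linarith)
  refine (ae_restrict_iff' hΩ.measurableSet).2 ?_
  filter_upwards [this] with x hx hxΩ
  have := hx hxΩ
  simp at this
  linarith

lemma HasWeakPartial.hasWeakPartial_weakPartial (h : HasWeakPartial Ω i f g) :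
    HasWeakPartial Ω i f (weakPartial Ω i f) := by
  have : ∃ g, HasWeakPartial Ω i f g := ⟨g, h⟩
  unfold weakPartial
  rw [dif_pos this]
  exact this.choose_spec

lemma HasWeakPartial.weakPartial_ae_eq (hΩ : IsOpen Ω) (h : HasWeakPartial Ω i f g) :
    weakPartial Ω i f =ᵐ[volume.restrict Ω] g :=
  h.hasWeakPartial_weakPartial.unique hΩ h

lemma weakPartial_congr (hΩ : IsOpen Ω) (hf : f =ᵐ[volume.restrict Ω] f') :
    weakPartial Ω i f =ᵐ[volume.restrict Ω] weakPartial Ω i f' := by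
  by_cases h : ∃ g, HasWeakPartial Ω i f g
  · obtain ⟨g, h⟩ := h
    exact (h.weakPartial_ae_eq hΩ).trans
      ((h.congr hf (ae_eq_refl _)).weakPartial_ae_eq hΩ).symm
  · have h' : ¬ ∃ g, HasWeakPartial Ω i f' g := fun ⟨g, hg⟩ =>
      h ⟨g, hg.congr hf.symm (ae_eq_refl _)⟩
    unfold weakPartial
    rw [dif_neg h, dif_neg h']

lemma HasWeakPartial.add (h : HasWeakPartial Ω i f g)
    (h' : HasWeakPartial Ω i f' g') : HasWeakPartial Ω i (f + f') (g + g') := by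
  rw [hasWeakPartial_iff] at *
  refine ⟨h.1.add h'.1, h.2.1.add h'.2.1, fun φ hφ => ?_⟩
  simp_rw [Pi.add_apply, add_mul]
  rw [integral_add ((hφ.isTest_partialDeriv i).integrable_mul h.1)
    ((hφ.isTest_partialDeriv i).integrable_mul h'.1),
    integral_add (hφ.integrable_mul h.2.1) (hφ.integrable_mul h'.2.1),
    h.2.2 φ hφ, h'.2.2 φ hφ]
  ring

lemma HasWeakPartial.neg (h : HasWeakPartial Ω i f g) : HasWeakPartial Ω i (-f) (-g) := by
  refine ⟨h.1.neg, h.2.1.neg, fun φ hφ => ?_⟩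
  simp_rw [Pi.neg_apply, neg_mul]
  rw [integral_neg, integral_neg, h.2.2 φ hφ]

lemma HasWeakPartial.sub (h : HasWeakPartial Ω i f g)
    (h' : HasWeakPartial Ω i f' g') : HasWeakPartial Ω i (f - f') (g - g') := by
  rw [sub_eq_add_neg, sub_eq_add_neg]
  exact h.add h'.neg

lemma HasWeakPartial.mono {Ω' : Set Plane} (hs : Ω' ⊆ Ω)
    (h : HasWeakPartial Ω i f g) : HasWeakPartial Ω' i f g := by
  rw [hasWeakPartial_iff] at h
  rw [hasWeakPartial_iff]
  exact ⟨h.1.mono_set hs, h.2.1.mono_set hs, fun φ hφ => h.2.2 φ (hφ.mono hs)⟩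

/-- Integration by parts against a test function. -/
lemma integral_mul_partialDeriv {χ : Plane → ℝ} (hχ : Differentiable ℝ χ) (hc : Continuous χ)
    (hc' : Continuous (partialDeriv i χ)) (hφ : IsTest Ω φ) :
    ∫ x, χ x * partialDeriv i φ x = -∫ x, partialDeriv i χ x * φ x := by
  refine integral_mul_fderiv_eq_neg_fderiv_mul_of_integrable ?_ ?_ ?_
    (fun x _ => hχ x) (fun x _ => hφ.differentiable x)
  · exact (hc'.mul hφ.continuous).integrable_of_hasCompactSupport hφ.2.1.mul_left
  · exact (hc.mul (hφ.isTest_partialDeriv i).continuous).integrable_of_hasCompactSupport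
      (hφ.isTest_partialDeriv i).2.1.mul_left
  · exact (hc.mul hφ.continuous).integrable_of_hasCompactSupport hφ.2.1.mul_left

lemma hasWeakPartial_of_differentiable {χ : Plane → ℝ} (hχ : Differentiable ℝ χ)
    (hc' : Continuous (partialDeriv i χ)) : HasWeakPartial Ω i χ (partialDeriv i χ) := by
  rw [hasWeakPartial_iff]
  exact ⟨hχ.continuous.locallyIntegrable.locallyIntegrableOn _,
    hc'.locallyIntegrable.locallyIntegrableOn _,
    fun φ hφ => integral_mul_partialDeriv hχ hχ.continuous hc' hφ⟩

lemma IsTest.hasWeakPartial {Ω' : Set Plane} (hφ : IsTest Ω' φ) (i : Fin 2) :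
    HasWeakPartial Ω i φ (partialDeriv i φ) :=
  hasWeakPartial_of_differentiable hφ.differentiable (hφ.isTest_partialDeriv i).continuous

/-- The Leibniz rule for a weak derivative and a smooth factor. -/
lemma HasWeakPartial.smooth_mul (hΩ : IsOpen Ω) {χ : Plane → ℝ} (hχ : ContDiff ℝ ∞ χ)
    (h : HasWeakPartial Ω i f g) :
    HasWeakPartial Ω i (χ * f) (partialDeriv i χ * f + χ * g) := by
  rw [hasWeakPartial_iff] at *
  have hl : ∀ {η k : Plane → ℝ}, Continuous η → LocallyIntegrableOn k Ω →
      LocallyIntegrableOn (η * k) Ω := fun hη hk =>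
    hk.continuousOn_mul hη.continuousOn hΩ.isLocallyClosed
  have hχ' := continuous_partialDeriv i hχ
  refine ⟨hl hχ.continuous h.1, (hl hχ' h.1).add (hl hχ.continuous h.2.1), fun φ hφ => ?_⟩
  have hT := hφ.smooth_mul hχ
  have e := h.2.2 _ hT
  rw [partialDeriv_mul i (differentiable_of_contDiff hχ) hφ.differentiable] at e
  have i1 : Integrable (fun x => f x * (partialDeriv i χ * φ) x) :=
    (hφ.smooth_mul (contDiff_partialDeriv i hχ)).integrable_mul h.1
  have i2 : Integrable (fun x => f x * (χ * partialDeriv i φ) x) :=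
    ((hφ.isTest_partialDeriv i).smooth_mul hχ).integrable_mul h.1
  have i3 : Integrable (fun x => g x * (χ * φ) x) := hT.integrable_mul h.2.1
  have e1 : ∀ x, f x * (partialDeriv i χ * φ + χ * partialDeriv i φ) x
    = f x * (partialDeriv i χ * φ) x + f x * (χ * partialDeriv i φ) x :=
    fun x => by simp; ring
  simp_rw [e1] at e
  rw [integral_add i1 i2] at e
  have e2 : ∀ x, (χ * f) x * partialDeriv i φ x
    = f x * (χ * partialDeriv i φ) x := fun x => by simp; ring
  have e3 : ∀ x, (partialDeriv i χ * f + χ * g) x * φ x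
    = f x * (partialDeriv i χ * φ) x + g x * (χ * φ) x := fun x => by simp; ring
  simp_rw [e2, e3]
  rw [integral_add i1 i3]
  linarith

/-! ### The spaces `H^k` and their norms -/

lemma MemH.memLp : ∀ {k : ℕ}, MemH Ω k f → MemLp f 2 (volume.restrict Ω)
  | 0, h => h
  | _ + 1, h => h.1

lemma MemH.congr (hΩ : IsOpen Ω) : ∀ {k : ℕ} {f f' : Plane → ℝ}, MemH Ω k f →
    f =ᵐ[volume.restrict Ω] f' → MemH Ω k f'
  | 0, f, f', h, e => (memLp_congr_ae e).1 h
  | k + 1, f, f', h, e => by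
    refine ⟨(memLp_congr_ae e).1 h.1, fun i => ⟨?_, ?_⟩⟩
    · obtain ⟨g, hg⟩ := (h.2 i).1
      exact ⟨g, hg.congr e (ae_eq_refl _)⟩
    · exact MemH.congr hΩ (h.2 i).2 (weakPartial_congr hΩ e)

lemma normSqH_congr (hΩ : IsOpen Ω) : ∀ {k : ℕ} {f f' : Plane → ℝ},
    f =ᵐ[volume.restrict Ω] f' → normSqH Ω k f = normSqH Ω k f'
  | 0, f, f', e => by simp only [normSqH]; rw [eLpNorm_congr_ae e]
  | k + 1, f, f', e => by
    simp only [normSqH]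
    rw [eLpNorm_congr_ae e]
    congr 1
    exact Finset.sum_congr rfl fun i _ => normSqH_congr hΩ (weakPartial_congr hΩ e)

/-- `H^{k+1}` in terms of arbitrary versions `w i` of the weak derivatives instead of the chosen
ones. -/
lemma memH_succ_iff (hΩ : IsOpen Ω) {k : ℕ} {w : Fin 2 → Plane → ℝ}
    (hw : ∀ i, HasWeakPartial Ω i f (w i)) :
    MemH Ω (k + 1) f ↔ MemLp f 2 (volume.restrict Ω) ∧ ∀ i, MemH Ω k (w i) := by
  simp only [MemH]
  refine and_congr_right fun _ => forall_congr' fun i => ?_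
  exact ⟨fun h => h.2.congr hΩ ((hw i).weakPartial_ae_eq hΩ),
    fun h => ⟨⟨_, hw i⟩, h.congr hΩ ((hw i).weakPartial_ae_eq hΩ).symm⟩⟩

lemma normSqH_succ (hΩ : IsOpen Ω) {k : ℕ} {w : Fin 2 → Plane → ℝ}
    (hw : ∀ i, HasWeakPartial Ω i f (w i)) :
    normSqH Ω (k + 1) f = eLpNorm f 2 (volume.restrict Ω) ^ 2 + ∑ i, normSqH Ω k (w i) := by
  simp only [normSqH]
  congr 1
  exact Finset.sum_congr rfl fun i _ => normSqH_congr hΩ ((hw i).weakPartial_ae_eq hΩ)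

lemma MemH.hasWeakPartial {k : ℕ} (h : MemH Ω (k + 1) f) (i : Fin 2) :
    HasWeakPartial Ω i f (weakPartial Ω i f) :=
  (h.2 i).1.choose_spec.hasWeakPartial_weakPartial

lemma MemH.add (hΩ : IsOpen Ω) : ∀ {k : ℕ} {f g : Plane → ℝ}, MemH Ω k f → MemH Ω k g →
    MemH Ω k (f + g)
  | 0, _, _, h, h' => MemLp.add h h'
  | _ + 1, _, _, h, h' =>
    (memH_succ_iff hΩ fun i => (h.hasWeakPartial i).add (h'.hasWeakPartial i)).2
      ⟨h.1.add h'.1, fun i => (h.2 i).2.add hΩ (h'.2 i).2⟩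

lemma MemH.neg (hΩ : IsOpen Ω) : ∀ {k : ℕ} {f : Plane → ℝ}, MemH Ω k f → MemH Ω k (-f)
  | 0, _, h => MemLp.neg h
  | _ + 1, _, h =>
    (memH_succ_iff hΩ fun i => (h.hasWeakPartial i).neg).2
      ⟨h.1.neg, fun i => (h.2 i).2.neg hΩ⟩

lemma MemH.sub (hΩ : IsOpen Ω) {k : ℕ} (h : MemH Ω k f) (h' : MemH Ω k g) :
    MemH Ω k (f - g) := by
  rw [sub_eq_add_neg]; exact h.add hΩ (h'.neg hΩ)

lemma sq_add_le_ennreal (a b : ℝ≥0∞) : (a + b) ^ 2 ≤ 2 * (a ^ 2 + b ^ 2) := by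
  have := ENNReal.rpow_add_le_mul_rpow_add_rpow a b (p := 2) (by norm_num)
  norm_num at this
  exact_mod_cast this

lemma normSqH_add_le (hΩ : IsOpen Ω) : ∀ {k : ℕ} {f g : Plane → ℝ}, MemH Ω k f → MemH Ω k g →
    normSqH Ω k (f + g) ≤ 2 * (normSqH Ω k f + normSqH Ω k g) := by
  have base : ∀ {f g : Plane → ℝ}, MemLp f 2 (volume.restrict Ω) → MemLp g 2 (volume.restrict Ω) →
      eLpNorm (f + g) 2 (volume.restrict Ω) ^ 2 ≤ 2 * (eLpNorm f 2 (volume.restrict Ω) ^ 2 +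
        eLpNorm g 2 (volume.restrict Ω) ^ 2) := fun h h' =>
    (pow_le_pow_left' (eLpNorm_add_le h.1 h'.1 (by norm_num)) 2).trans (sq_add_le_ennreal _ _)
  intro k
  induction k with
  | zero => intro f g h h'; exact base h h'
  | succ k ih =>
    intro f g h h'
    rw [normSqH_succ hΩ fun i => (h.hasWeakPartial i).add (h'.hasWeakPartial i)]
    simp only [normSqH]
    calc _ ≤ 2 * (eLpNorm f 2 (volume.restrict Ω) ^ 2 + eLpNorm g 2 (volume.restrict Ω) ^ 2)
        + ∑ i, 2 * (normSqH Ω k (weakPartial Ω i f) + normSqH Ω k (weakPartial Ω i g)) :=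
          add_le_add (base h.1 h'.1) (Finset.sum_le_sum fun i _ => ih (h.2 i).2 (h'.2 i).2)
      _ = _ := by
        rw [← Finset.mul_sum, Finset.sum_add_distrib]; ring

lemma normSqH_neg (hΩ : IsOpen Ω) : ∀ {k : ℕ} {f : Plane → ℝ}, MemH Ω k f →
    normSqH Ω k (-f) = normSqH Ω k f
  | 0, _, _ => by simp [normSqH, eLpNorm_neg]
  | k + 1, f, h => by
    rw [normSqH_succ hΩ fun i => (h.hasWeakPartial i).neg]
    simp only [normSqH, eLpNorm_neg]
    congr 1
    exact Finset.sum_congr rfl fun i _ => normSqH_neg hΩ (h.2 i).2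

lemma IsTest.memH {Ω' : Set Plane} (hΩ : IsOpen Ω) : ∀ {k : ℕ} {φ : Plane → ℝ}, IsTest Ω' φ →
    MemH Ω k φ
  | 0, _, h => h.memLp 2 _
  | _ + 1, _, h => (memH_succ_iff hΩ fun i => h.hasWeakPartial i).2
      ⟨h.memLp 2 _, fun i => (h.isTest_partialDeriv i).memH hΩ⟩

lemma MemH.mono {Ω' : Set Plane} (hΩ : IsOpen Ω) (hΩ' : IsOpen Ω') (hs : Ω' ⊆ Ω) :
    ∀ {k : ℕ} {f : Plane → ℝ}, MemH Ω k f → MemH Ω' k f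
  | 0, _, h => MemLp.mono_measure (Measure.restrict_mono hs le_rfl) h
  | _ + 1, _, h => (memH_succ_iff hΩ' fun i => (h.hasWeakPartial i).mono hs).2
      ⟨h.1.mono_measure (Measure.restrict_mono hs le_rfl), fun i => (h.2 i).2.mono hΩ hΩ' hs⟩

lemma normSqH_mono {Ω' : Set Plane} (hΩ : IsOpen Ω) (hΩ' : IsOpen Ω') (hs : Ω' ⊆ Ω) :
    ∀ {k : ℕ} {f : Plane → ℝ}, MemH Ω k f → normSqH Ω' k f ≤ normSqH Ω k f
  | 0, f, _ => by
    simp only [normSqH]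
    exact pow_le_pow_left' (eLpNorm_mono_measure f (Measure.restrict_mono hs le_rfl)) 2
  | k + 1, f, h => by
    rw [normSqH_succ hΩ' fun i => (h.hasWeakPartial i).mono hs]
    simp only [normSqH]
    exact add_le_add
      (pow_le_pow_left' (eLpNorm_mono_measure f (Measure.restrict_mono hs le_rfl)) 2)
      (Finset.sum_le_sum fun i _ => normSqH_mono hΩ hΩ' hs (h.2 i).2)

lemma eLpNorm_sq_le_normSqH : ∀ {k : ℕ} {f : Plane → ℝ},
    eLpNorm f 2 (volume.restrict Ω) ^ 2 ≤ normSqH Ω k f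
  | 0, _ => le_rfl
  | _ + 1, _ => le_self_add

lemma normSqH_weakPartial_le {k : ℕ} (i : Fin 2) :
    normSqH Ω k (weakPartial Ω i f) ≤ normSqH Ω (k + 1) f := by
  simp only [normSqH]
  exact (Finset.single_le_sum (f := fun i => normSqH Ω k (weakPartial Ω i f))
    (fun _ _ => zero_le) (Finset.mem_univ i)).trans le_add_self

/-! ### The spaces `H^k_0` -/

lemma MemH0.add (hΩ : IsOpen Ω) {k : ℕ} (h : MemH0 Ω k f) (h' : MemH0 Ω k g) :
    MemH0 Ω k (f + g) := by
  refine ⟨h.1.add hΩ h'.1, fun ε hε => ?_⟩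
  have hε' : 0 < ε / 4 := ENNReal.div_pos hε.ne' (by norm_num)
  obtain ⟨φ, hφ, h1⟩ := h.2 _ hε'
  obtain ⟨θ, hθ, h2⟩ := h'.2 _ hε'
  refine ⟨φ + θ, hφ.add hθ, ?_⟩
  rw [add_sub_add_comm]
  refine (normSqH_add_le hΩ (h.1.sub hΩ (hφ.memH hΩ)) (h'.1.sub hΩ (hθ.memH hΩ))).trans_lt ?_
  calc _ < 2 * (ε / 4 + ε / 4) := by
        exact (ENNReal.mul_lt_mul_iff_right (by norm_num) (by norm_num)).2
          (ENNReal.add_lt_add h1 h2)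
    _ = ε := by
        rw [← two_mul, ← mul_assoc]; norm_num
        exact ENNReal.mul_div_cancel (by norm_num) (by norm_num)

lemma MemH0.neg (hΩ : IsOpen Ω) {k : ℕ} (h : MemH0 Ω k f) : MemH0 Ω k (-f) := by
  refine ⟨h.1.neg hΩ, fun ε hε => ?_⟩
  obtain ⟨φ, hφ, h1⟩ := h.2 _ hε
  refine ⟨-φ, hφ.neg, ?_⟩
  rw [← neg_sub', normSqH_neg hΩ (h.1.sub hΩ (hφ.memH hΩ))]
  exact h1

lemma MemH0.memH0_weakPartial (hΩ : IsOpen Ω) {k : ℕ} (h : MemH0 Ω (k + 1) f) (i : Fin 2) :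
    MemH0 Ω k (weakPartial Ω i f) := by
  refine ⟨(h.1.2 i).2, fun ε hε => ?_⟩
  obtain ⟨φ, hφ, h1⟩ := h.2 _ hε
  refine ⟨_, hφ.isTest_partialDeriv i,
    lt_of_le_of_lt (le_of_eq_of_le ?_ (normSqH_weakPartial_le i)) h1⟩
  exact (normSqH_congr hΩ
    (((h.1.hasWeakPartial i).sub (hφ.hasWeakPartial i)).weakPartial_ae_eq hΩ)).symm

lemma normSqH_zero (hΩ : IsOpen Ω) {k : ℕ} : normSqH Ω k 0 = 0 := by
  induction k with
  | zero => simp [normSqH]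
  | succ k ih =>
    rw [normSqH_succ hΩ (w := fun _ => 0), ih]
    · simp
    · intro i
      have := (isTest_zero (Ω := Ω)).hasWeakPartial (Ω := Ω) i
      convert this using 1
      funext x; simp [partialDeriv]

lemma IsTest.memH0 (hΩ : IsOpen Ω) {k : ℕ} (h : IsTest Ω φ) : MemH0 Ω k φ :=
  ⟨h.memH hΩ, fun ε hε => ⟨φ, h, by rwa [sub_self, normSqH_zero hΩ]⟩⟩

/-- `H^k_0` is closed in `H^k`. -/
lemma memH0_of_forall_approx (hΩ : IsOpen Ω) {k : ℕ} (hf : MemH Ω k f)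
    (h : ∀ ε : ℝ≥0∞, 0 < ε → ∃ g, MemH0 Ω k g ∧ normSqH Ω k (f - g) < ε) : MemH0 Ω k f := by
  refine ⟨hf, fun ε hε => ?_⟩
  have hε' : 0 < ε / 4 := ENNReal.div_pos hε.ne' (by norm_num)
  obtain ⟨g, hg, h1⟩ := h _ hε'
  obtain ⟨φ, hφ, h2⟩ := hg.2 _ hε'
  refine ⟨φ, hφ, ?_⟩
  rw [← sub_add_sub_cancel f g φ]
  refine (normSqH_add_le hΩ (hf.sub hΩ hg.1) (hg.1.sub hΩ (hφ.memH hΩ))).trans_lt ?_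
  calc _ < 2 * (ε / 4 + ε / 4) := by
        exact (ENNReal.mul_lt_mul_iff_right (by norm_num) (by norm_num)).2
          (ENNReal.add_lt_add h1 h2)
    _ = ε := by
        rw [← two_mul, ← mul_assoc]; norm_num
        exact ENNReal.mul_div_cancel (by norm_num) (by norm_num)

/-! ### Limits in `L²` -/

lemma tendsto_integral_mul_of_tendsto_eLpNorm {μ : Measure Plane} {F : ℕ → Plane → ℝ}
    (hg : MemLp g 2 μ) (hF : ∀ n, MemLp (F n) 2 μ) (hf : MemLp f 2 μ)
    (h : Tendsto (fun n => eLpNorm (f - F n) 2 μ) atTop (𝓝 0)) :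
    Tendsto (fun n => ∫ x, g x * F n x ∂μ) atTop (𝓝 (∫ x, g x * f x ∂μ)) := by
  refine tendsto_integral_of_L1 _ (hg.integrable_mul hf).1
    (Eventually.of_forall fun n => hg.integrable_mul (hF n)) ?_
  refine tendsto_of_tendsto_of_tendsto_of_le_of_le (g := fun _ => 0)
    (h := fun n => eLpNorm g 2 μ * eLpNorm (f - F n) 2 μ) tendsto_const_nhds ?_
    (fun _ => zero_le) ?_
  · simpa using ENNReal.Tendsto.const_mul h (Or.inr hg.eLpNorm_ne_top)
  · intro n
    have := eLpNorm_smul_le_mul_eLpNorm (p := 2) (q := 2) (r := 1) (hf.sub (hF n)).1 hg.1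
    rw [eLpNorm_one_eq_lintegral_enorm] at this
    refine le_trans (le_of_eq ?_) this
    refine lintegral_congr fun x => ?_
    rw [← enorm_neg]
    congr 1
    simp
    ring

lemma tendsto_eLpNorm_of_normSqH {k : ℕ} {F : ℕ → Plane → ℝ}
    (h : Tendsto (fun n => normSqH Ω k (F n)) atTop (𝓝 0)) :
    Tendsto (fun n => eLpNorm (F n) 2 (volume.restrict Ω)) atTop (𝓝 0) := by
  have h1 : Tendsto (fun n => eLpNorm (F n) 2 (volume.restrict Ω) ^ 2) atTop (𝓝 0) :=
    tendsto_of_tendsto_of_tendsto_of_le_of_le tendsto_const_nhds h (fun _ => zero_le)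
      (fun _ => eLpNorm_sq_le_normSqH)
  have h2 := (ENNReal.continuous_rpow_const (y := ((2 : ℕ) : ℝ)⁻¹)).tendsto 0 |>.comp h1
  simp only [Function.comp_def, ENNReal.pow_rpow_inv_natCast (two_ne_zero)] at h2
  simpa using h2

lemma MemH0.exists_seq {k : ℕ} (h : MemH0 Ω k f) : ∃ φ : ℕ → Plane → ℝ,
    (∀ n, IsTest Ω (φ n)) ∧ Tendsto (fun n => normSqH Ω k (f - φ n)) atTop (𝓝 0) := by
  have : ∀ n : ℕ, ∃ φ, IsTest Ω φ ∧ normSqH Ω k (f - φ) < ((n : ℝ≥0∞) + 1)⁻¹ := fun n =>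
    h.2 _ (by simp)
  choose φ h1 h2 using this
  refine ⟨φ, h1, tendsto_of_tendsto_of_tendsto_of_le_of_le tendsto_const_nhds
    ?_ (fun _ => zero_le) (fun n => (h2 n).le)⟩
  have := ENNReal.tendsto_inv_nat_nhds_zero.comp (tendsto_add_atTop_nat 1)
  simpa [Function.comp_def] using this

/-- Convergence in `H^{k+1}` implies convergence of the derivatives in `H^k`. -/
lemma tendsto_normSqH_weakPartial (hΩ : IsOpen Ω) {k : ℕ} {w : Plane → ℝ} {φ : ℕ → Plane → ℝ}
    (hw : HasWeakPartial Ω i f w) (hφ : ∀ n, IsTest Ω (φ n))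
    (h : Tendsto (fun n => normSqH Ω (k + 1) (f - φ n)) atTop (𝓝 0)) :
    Tendsto (fun n => normSqH Ω k (w - partialDeriv i (φ n))) atTop (𝓝 0) := by
  refine tendsto_of_tendsto_of_tendsto_of_le_of_le tendsto_const_nhds h (fun _ => zero_le)
    fun n => le_of_eq_of_le ?_ (normSqH_weakPartial_le i)
  exact (normSqH_congr hΩ ((hw.sub ((hφ n).hasWeakPartial i)).weakPartial_ae_eq hΩ)).symm

/-! ### Second derivatives of `H²_0` functions -/

/-- Weak mixed derivatives commute: if `∂ⱼ∂ᵢf` exists, so does `∂ᵢ∂ⱼf`, provided `∂ⱼf` does. -/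
lemma HasWeakPartial.comm {a b c : Plane → ℝ} (hi : HasWeakPartial Ω i f a)
    (hj : HasWeakPartial Ω j f b) (hji : HasWeakPartial Ω j a c) : HasWeakPartial Ω i b c := by
  refine ⟨hj.2.1, hji.2.1, fun φ hφ => ?_⟩
  have h1 := hj.2.2 _ (hφ.isTest_partialDeriv i)
  have h2 := hi.2.2 _ (hφ.isTest_partialDeriv j)
  have h3 := hji.2.2 _ hφ
  rw [partialDeriv_comm hφ.1 j i] at h1
  linarith

lemma HasWeakPartial.integral_mul_partialDeriv_comm {a b : Plane → ℝ}
    (hi : HasWeakPartial Ω i f a) (hj : HasWeakPartial Ω j f b) (hφ : IsTest Ω φ) :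
    ∫ x in Ω, a x * partialDeriv j φ x = ∫ x in Ω, b x * partialDeriv i φ x := by
  have h1 := hi.2.2 _ (hφ.isTest_partialDeriv j)
  have h2 := hj.2.2 _ (hφ.isTest_partialDeriv i)
  rw [partialDeriv_comm hφ.1 i j] at h1
  linarith

/-- The Hessian determinant of an `H²_0` function has integral zero. With a test function in place
of the second factor this is an integration by parts; both sides are continuous in that factor for
the `H²` norm. -/
lemma MemH0.integral_hessian (hΩ : IsOpen Ω) (h : MemH0 Ω 2 f) :
    ∫ x in Ω, weakPartial Ω i (weakPartial Ω i f) x * weakPartial Ω j (weakPartial Ω j f) x =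
    ∫ x in Ω, weakPartial Ω j (weakPartial Ω i f) x * weakPartial Ω i (weakPartial Ω j f) x := by
  obtain ⟨φ, hφ, hlim⟩ := h.exists_seq
  have hm : ∀ a b, MemLp (weakPartial Ω a (weakPartial Ω b f)) 2 (volume.restrict Ω) :=
    fun a b => ((h.1.2 b).2.2 a).2
  have hw : ∀ a b, HasWeakPartial Ω a (weakPartial Ω b f) (weakPartial Ω a (weakPartial Ω b f)) :=
    fun a b => MemH.hasWeakPartial (k := 0) (h.1.2 b).2 a
  have key : ∀ a b c d, Tendsto (fun n => ∫ x in Ω, weakPartial Ω a (weakPartial Ω b f) x *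
      partialDeriv c (partialDeriv d (φ n)) x) atTop
      (𝓝 (∫ x in Ω, weakPartial Ω a (weakPartial Ω b f) x *
        weakPartial Ω c (weakPartial Ω d f) x)) := fun a b c d => by
    refine tendsto_integral_mul_of_tendsto_eLpNorm (hm a b)
      (fun n => (((hφ n).isTest_partialDeriv d).isTest_partialDeriv c).memLp 2 _) (hm c d) ?_
    exact tendsto_eLpNorm_of_normSqH (k := 0) (tendsto_normSqH_weakPartial hΩ (hw c d)
      (fun n => (hφ n).isTest_partialDeriv d)
      (tendsto_normSqH_weakPartial hΩ (h.1.hasWeakPartial d) hφ hlim))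
  refine tendsto_nhds_unique (key i i j j) ((key j i i j).congr fun n => ?_)
  exact (hw j i).integral_mul_partialDeriv_comm (hw i i) ((hφ n).isTest_partialDeriv j)

/-- The bending energy of an `H²_0` function is the squared `L²` norm of its Hessian. -/
lemma MemH0.bendingEnergy_eq (hΩ : IsOpen Ω) (h : MemH0 Ω 2 f) :
    bendingEnergy Ω f =
      ∫ x in Ω, ∑ i, ∑ j, weakPartial Ω i (weakPartial Ω j f) x ^ 2 := by
  have hm : ∀ a b, MemLp (weakPartial Ω a (weakPartial Ω b f)) 2 (volume.restrict Ω) :=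
    fun a b => ((h.1.2 b).2.2 a).2
  have hw : ∀ a b, HasWeakPartial Ω a (weakPartial Ω b f) (weakPartial Ω a (weakPartial Ω b f)) :=
    fun a b => MemH.hasWeakPartial (k := 0) (h.1.2 b).2 a
  have hsymm : weakPartial Ω 0 (weakPartial Ω 1 f) =ᵐ[volume.restrict Ω]
      weakPartial Ω 1 (weakPartial Ω 0 f) :=
    ((h.1.hasWeakPartial 0).comm (h.1.hasWeakPartial 1) (hw 1 0)).weakPartial_ae_eq hΩ
  have hdet := h.integral_hessian hΩ (i := 0) (j := 1)
  have hi : ∀ a b c d, Integrable (fun x => weakPartial Ω a (weakPartial Ω b f) x *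
    weakPartial Ω c (weakPartial Ω d f) x) (volume.restrict Ω) :=
    fun a b c d => (hm a b).integrable_mul (hm c d)
  have e1 : bendingEnergy Ω f = ∫ x in Ω, ((∑ i, ∑ j, weakPartial Ω i (weakPartial Ω j f) x ^ 2) +
      2 * (weakPartial Ω 0 (weakPartial Ω 0 f) x * weakPartial Ω 1 (weakPartial Ω 1 f) x -
      weakPartial Ω 1 (weakPartial Ω 0 f) x * weakPartial Ω 0 (weakPartial Ω 1 f) x)) := by
    refine integral_congr_ae ?_
    filter_upwards [hsymm] with x hx
    simp only [weakLaplacian, Fin.sum_univ_two, hx]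
    ring
  rw [e1, integral_add, integral_const_mul, integral_sub (hi _ _ _ _) (hi _ _ _ _), hdet]
  · simp
  · exact integrable_finsetSum _ fun a _ => integrable_finsetSum _ fun b _ => (hm a b).integrable_sq
  · exact ((hi _ _ _ _).sub (hi _ _ _ _)).const_mul 2

/-- The stream function correspondence at the level of energies: if the perpendicular gradient of
`ψ` is `u`, the two Rayleigh quotients agree. -/
lemma energies_eq (hΩ : IsOpen Ω) {ψ : Plane → ℝ} {u : Plane → Plane} (h : MemH0 Ω 2 ψ)
    (h0 : (fun x => u x 0) =ᵐ[volume.restrict Ω] weakPartial Ω 1 ψ)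
    (h1 : (fun x => u x 1) =ᵐ[volume.restrict Ω] -weakPartial Ω 0 ψ) :
    dirichletEnergyVec Ω u = bendingEnergy Ω ψ ∧ kineticEnergy Ω u = dirichletEnergy Ω ψ := by
  constructor
  · rw [h.bendingEnergy_eq hΩ]
    have e0 : ∀ i, weakPartial Ω i (fun x => u x 0) =ᵐ[volume.restrict Ω]
      weakPartial Ω i (weakPartial Ω 1 ψ) := fun i => weakPartial_congr hΩ h0
    have e1 : ∀ i, weakPartial Ω i (fun x => u x 1) =ᵐ[volume.restrict Ω]
      -weakPartial Ω i (weakPartial Ω 0 ψ) := fun i => (weakPartial_congr hΩ h1).trans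
        (((MemH.hasWeakPartial (k := 0) (h.1.2 0).2 i).neg).weakPartial_ae_eq hΩ)
    refine integral_congr_ae ?_
    filter_upwards [e0 0, e0 1, e1 0, e1 1] with x a b c d
    simp only [Fin.sum_univ_two, a, b, c, d, Pi.neg_apply]
    ring
  · refine integral_congr_ae ?_
    filter_upwards [h0, h1] with x a b
    simp only [EuclideanSpace.norm_sq_eq, Fin.sum_univ_two, a, b, Pi.neg_apply, Real.norm_eq_abs,
      sq_abs]
    ring

/-- The perpendicular gradient of an `H²_0` function is an admissible velocity field. -/
lemma MemH0.exists_velocity (hΩ : IsOpen Ω) {ψ : Plane → ℝ} (h : MemH0 Ω 2 ψ) :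
    ∃ u, MemH10Vec Ω u ∧ IsDivFree Ω u ∧ dirichletEnergyVec Ω u = bendingEnergy Ω ψ ∧
      kineticEnergy Ω u = dirichletEnergy Ω ψ := by
  let u : Plane → Plane := fun x => !₂[weakPartial Ω 1 ψ x, -weakPartial Ω 0 ψ x]
  have h0 : (fun x => u x 0) = weakPartial Ω 1 ψ := by funext x; simp [u]
  have h1 : (fun x => u x 1) = -weakPartial Ω 0 ψ := by funext x; simp [u]
  refine ⟨u, ?_, ?_, energies_eq hΩ h (by rw [h0]) (by rw [h1])⟩
  · intro j
    fin_cases j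
    · change MemH0 Ω 1 (fun x => u x 0)
      rw [h0]; exact h.memH0_weakPartial hΩ 1
    · change MemH0 Ω 1 (fun x => u x 1)
      rw [h1]; exact (h.memH0_weakPartial hΩ 0).neg hΩ
  · have hw : ∀ a b, HasWeakPartial Ω a (weakPartial Ω b ψ)
        (weakPartial Ω a (weakPartial Ω b ψ)) :=
      fun a b => MemH.hasWeakPartial (k := 0) (h.1.2 b).2 a
    have hsymm := ((h.1.hasWeakPartial 0).comm (h.1.hasWeakPartial 1) (hw 1 0)).weakPartial_ae_eq hΩ
    have hneg := (hw 1 0).neg.weakPartial_ae_eq hΩ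
    unfold IsDivFree
    simp only [Fin.sum_univ_two]
    rw [h0, h1]
    filter_upwards [hsymm, hneg] with x a b
    rw [a, b]
    simp

/-- The set of buckling quotients is nonempty, so that its infimum is not the junk value `0`. -/
lemma exists_dirichletEnergy_ne_zero (hΩ : IsOpen Ω) (hne : Ω.Nonempty) :
    ∃ ψ, MemH0 Ω 2 ψ ∧ dirichletEnergy Ω ψ ≠ 0 := by
  obtain ⟨p, hp⟩ := hne
  obtain ⟨φ, hφt, hφc, hφs, -, hφ1⟩ := exists_contDiff_tsupport_subset (n := ⊤) (hΩ.mem_nhds hp)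
  have hφ : IsTest Ω φ := ⟨hφs, hφc, hφt⟩
  refine ⟨φ, hφ.memH0 hΩ, ?_⟩
  have e : dirichletEnergy Ω φ = ∫ x, ∑ i, partialDeriv i φ x ^ 2 := by
    rw [← setIntegral_eq_integral_of_forall_compl_eq_zero (s := Ω)]
    · refine integral_congr_ae ?_
      filter_upwards [(hφ.hasWeakPartial (Ω := Ω) 0).weakPartial_ae_eq hΩ,
        (hφ.hasWeakPartial (Ω := Ω) 1).weakPartial_ae_eq hΩ] with x a b
      simp only [Fin.sum_univ_two, a, b]
    · intro x hx
      simp [(hφ.isTest_partialDeriv _).eq_zero hx]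
  -- A function with vanishing gradient is constant, and a compactly supported constant is zero.
  have hx : ∃ x, ∑ i, partialDeriv i φ x ^ 2 ≠ 0 := by
    by_contra! hall
    have hfd : ∀ x, fderiv ℝ φ x = 0 := fun x => by
      have hi : ∀ i, partialDeriv i φ x = 0 := fun i => by
        have := (Finset.sum_eq_zero_iff_of_nonneg (fun i _ => sq_nonneg (partialDeriv i φ x))).1
          (hall x) i (Finset.mem_univ i)
        exact pow_eq_zero_iff (two_ne_zero) |>.1 this
      refine ContinuousLinearMap.coe_injective
        ((EuclideanSpace.basisFun (Fin 2) ℝ).toBasis.ext fun i => ?_)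
      simpa [partialDeriv] using hi i
    have hconst := is_const_of_fderiv_eq_zero hφ.differentiable hfd
    obtain ⟨y, hy⟩ : ∃ y, φ y = 0 := by
      by_contra! hy
      have : tsupport φ = univ := by
        rw [eq_univ_iff_forall]; exact fun y => subset_tsupport φ (hy y)
      exact noncompact_univ Plane (this ▸ hφc)
    have := hconst p y
    rw [hφ1, hy] at this
    exact one_ne_zero this
  obtain ⟨x, hx⟩ := hx
  rw [e]
  refine (Continuous.integral_pos_of_hasCompactSupport_nonneg_nonzero (μ := volume)
    (f := fun x => ∑ i, partialDeriv i φ x ^ 2)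
    ?_ ?_ ?_ hx).ne'
  · exact continuous_finsetSum _ fun i _ => (hφ.isTest_partialDeriv i).continuous.pow 2
  · refine hφc.mono' (fun y hy => ?_)
    by_contra hy'
    exact hy (by simp [image_eq_zero_of_notMem_tsupport
      (fun h => hy' (tsupport_partialDeriv_subset _ φ h))])
  · intro y; exact Finset.sum_nonneg fun i _ => sq_nonneg _

lemma lambdaS_le_lambdaB (hΩ : IsOpen Ω) (hne : Ω.Nonempty) : lambdaS Ω ≤ lambdaB Ω := by
  obtain ⟨ψ, hψ, hψ0⟩ := exists_dirichletEnergy_ne_zero hΩ hne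
  refine csInf_le_csInf ⟨0, ?_⟩ ⟨_, ψ, hψ, hψ0, rfl⟩ ?_
  · rintro q ⟨u, -, -, -, rfl⟩
    exact div_nonneg (integral_nonneg fun x => Finset.sum_nonneg fun i _ =>
      Finset.sum_nonneg fun j _ => sq_nonneg _) (integral_nonneg fun x => by positivity)
  · rintro q ⟨ψ, h, h0, rfl⟩
    obtain ⟨u, hu, hdiv, e1, e2⟩ := h.exists_velocity hΩ
    exact ⟨u, hu, hdiv, by rwa [e2], by rw [e1, e2]⟩

/-! ### Primitives along coordinate lines -/

/-- The point obtained from `x` by setting its `i`-th coordinate to `s`. -/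
def coordLine (i : Fin 2) (x : Plane) (s : ℝ) : Plane := x + (s - x i) • EuclideanSpace.single i 1

lemma coordLine_self (i : Fin 2) (x : Plane) : coordLine i x (x i) = x := by simp [coordLine]

lemma coordLine_apply_self (i : Fin 2) (x : Plane) (s : ℝ) : coordLine i x s i = s := by
  simp [coordLine]

lemma coordLine_apply_of_ne (h : j ≠ i) (x : Plane) (s : ℝ) : coordLine i x s j = x j := by
  simp [coordLine, h]

lemma coordLine_coordLine (i : Fin 2) (x : Plane) (s t : ℝ) :
    coordLine i (coordLine i x s) t = coordLine i x t := by
  ext j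
  by_cases h : j = i
  · subst h; simp [coordLine_apply_self]
  · simp [coordLine_apply_of_ne h]

lemma continuous_coordLine (i : Fin 2) : Continuous fun q : Plane × ℝ => coordLine i q.1 q.2 := by
  unfold coordLine
  fun_prop

lemma IsTest.contDiff_line (h : IsTest Ω φ) (i : Fin 2) (x : Plane) :
    ContDiff ℝ ∞ fun s => φ (coordLine i x s) :=
  h.1.comp (contDiff_const.add ((contDiff_id.sub contDiff_const).smul contDiff_const))

lemma IsTest.exists_radius (h : IsTest Ω φ) : ∃ R : ℝ, ∀ x : Plane, ∀ i, R < |x i| → φ x = 0 := by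
  obtain ⟨R, hR⟩ := h.2.1.isBounded.subset_closedBall 0
  refine ⟨R, fun x i hx => image_eq_zero_of_notMem_tsupport fun hx' => ?_⟩
  have h1 := mem_closedBall_zero_iff.1 (hR hx')
  exact absurd ((PiLp.norm_apply_le x i).trans h1) (not_le.2 hx)

lemma IsTest.hasCompactSupport_line (h : IsTest Ω φ) (i : Fin 2) (x : Plane) :
    HasCompactSupport fun s => φ (coordLine i x s) := by
  obtain ⟨R, hR⟩ := h.exists_radius
  refine HasCompactSupport.intro (isCompact_Icc (a := -R) (b := R)) fun s hs => hR _ i ?_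
  rw [coordLine_apply_self]
  by_contra! hle
  exact hs (abs_le.1 hle)

lemma IsTest.integrable_line (h : IsTest Ω φ) (i : Fin 2) (x : Plane) :
    Integrable fun s => φ (coordLine i x s) :=
  (h.contDiff_line i x).continuous.integrable_of_hasCompactSupport (h.hasCompactSupport_line i x)

lemma IsTest.deriv_line (h : IsTest Ω φ) (i : Fin 2) (x : Plane) (s : ℝ) :
    deriv (fun s => φ (coordLine i x s)) s = partialDeriv i φ (coordLine i x s) := by
  have h1 : HasDerivAt (coordLine i x) (EuclideanSpace.single i 1) s := by
    have := ((((hasDerivAt_id s).sub_const (x i)).smul_const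
      (EuclideanSpace.single i (1 : ℝ))).const_add x)
    rw [one_smul] at this
    exact this
  exact ((h.differentiable _).hasFDerivAt.comp_hasDerivAt s h1).deriv

/-- The primitive of `φ` in the `i`-th coordinate which vanishes far to the left. -/
def primitive (i : Fin 2) (φ : Plane → ℝ) (x : Plane) : ℝ :=
  ∫ s in Iic (x i), φ (coordLine i x s)

lemma IsTest.primitive_partialDeriv (h : IsTest Ω φ) (i : Fin 2) (x : Plane) :
    primitive i (partialDeriv i φ) x = φ x := by
  have := HasCompactSupport.integral_Iic_deriv_eq ((h.contDiff_line i x).of_le (by simp))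
    (h.hasCompactSupport_line i x) (x i)
  rw [coordLine_self] at this
  rw [← this]
  simp_rw [h.deriv_line]
  rfl

lemma IsTest.primitive_sub_primitive (h : IsTest Ω φ) (i : Fin 2) (x : Plane) (s : ℝ) :
    primitive i φ (coordLine i x s) - primitive i φ x =
      ∫ t in (x i)..s, φ (coordLine i x t) := by
  unfold primitive
  simp_rw [coordLine_coordLine, coordLine_apply_self]
  exact intervalIntegral.integral_Iic_sub_Iic (h.integrable_line i x).integrableOn
    (h.integrable_line i x).integrableOn

lemma primitive_sub (h : IsTest Ω φ) (h' : IsTest Ω θ) (i : Fin 2) (x : Plane) :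
    primitive i (φ - θ) x = primitive i φ x - primitive i θ x :=
  integral_sub (h.integrable_line i x).integrableOn (h'.integrable_line i x).integrableOn

lemma IsTest.hasLineDerivAt_primitive (h : IsTest Ω φ) (i : Fin 2) (x : Plane) :
    HasLineDerivAt ℝ (primitive i φ) (φ x) x (EuclideanSpace.single i 1) := by
  unfold HasLineDerivAt
  have hc : Continuous fun t => φ (coordLine i x t) := (h.contDiff_line i x).continuous
  have h1 : HasDerivAt (fun s => ∫ t in (x i)..s, φ (coordLine i x t)) (φ x) (x i) := by
    have := intervalIntegral.integral_hasDerivAt_right (a := x i) (b := x i)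
      (hc.intervalIntegrable _ _) (hc.stronglyMeasurableAtFilter _ _) hc.continuousAt
    simpa only [coordLine_self] using this
  have h2 : HasDerivAt (fun s => primitive i φ (coordLine i x s)) (φ x) (x i) := by
    refine (h1.add_const (primitive i φ x)).congr_of_eventuallyEq (Eventually.of_forall fun s => ?_)
    simp only
    rw [← h.primitive_sub_primitive]
    ring
  have h3 : HasDerivAt (fun t : ℝ => x i + t) 1 0 := (hasDerivAt_id 0).const_add _
  have h4 := HasDerivAt.comp (h₂ := fun s => primitive i φ (coordLine i x s)) (0 : ℝ)
    (by simpa using h2) h3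
  simpa [Function.comp_def, coordLine] using h4

lemma IsTest.continuous_primitive (h : IsTest Ω φ) (i : Fin 2) : Continuous (primitive i φ) := by
  obtain ⟨R, hR⟩ := h.exists_radius
  have heq : primitive i φ = fun x => ∫ s in (-(|R| + 1))..(x i), φ (coordLine i x s) := by
    funext x
    have h1 := h.primitive_sub_primitive i (coordLine i x (-(|R| + 1))) (x i)
    simp only [coordLine_coordLine, coordLine_self, coordLine_apply_self] at h1
    have h2 : primitive i φ (coordLine i x (-(|R| + 1))) = 0 := by
      unfold primitive
      rw [coordLine_apply_self]
      refine setIntegral_eq_zero_of_forall_eq_zero fun s hs => hR _ i ?_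
      rw [coordLine_apply_self, lt_abs]
      right
      have : s ≤ -(|R| + 1) := hs
      linarith [le_abs_self R]
    rw [← h1, h2, sub_zero]
  rw [heq]
  exact intervalIntegral.continuous_parametric_intervalIntegral_of_continuous
    (f := fun x s => φ (coordLine i x s))
    (h.continuous.comp (continuous_coordLine i)) (by fun_prop)

/-- Integration by parts for the primitive in its own direction. -/
lemma IsTest.integral_primitive_mul (h : IsTest Ω φ) {Ω' : Set Plane} (hθ : IsTest Ω' θ)
    (i : Fin 2) :
    ∫ x, primitive i φ x * partialDeriv i θ x = -∫ x, φ x * θ x := by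
  have hc := h.continuous_primitive i
  refine integral_bilinear_hasLineDerivAt_right_eq_neg_left_of_integrable
    (B := ContinuousLinearMap.mul ℝ ℝ) (v := EuclideanSpace.single i 1) ?_ ?_ ?_
    (fun x _ => h.hasLineDerivAt_primitive i x)
    (fun x _ => (hθ.differentiable x).hasFDerivAt.hasLineDerivAt _)
  · exact (h.continuous.mul hθ.continuous).integrable_of_hasCompactSupport hθ.2.1.mul_left
  · exact (hc.mul (hθ.isTest_partialDeriv i).continuous).integrable_of_hasCompactSupport
      (hθ.isTest_partialDeriv i).2.1.mul_left
  · exact (hc.mul hθ.continuous).integrable_of_hasCompactSupport hθ.2.1.mul_left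

/-! ### The two primitives of a nearly divergence free field -/

lemma measurePreserving_prod_plane :
    MeasurePreserving (fun q : ℝ × ℝ => (!₂[q.1, q.2] : Plane)) volume volume := by
  have h1 := (volume_preserving_finTwoArrow ℝ).symm
  have h2 := (PiLp.volume_preserving_toLp (Fin 2)).comp h1
  exact h2

lemma lintegral_plane {F : Plane → ℝ≥0∞} (hF : Measurable F) :
    ∫⁻ x, F x = ∫⁻ t, ∫⁻ s, F !₂[s, t] := by
  rw [← measurePreserving_prod_plane.lintegral_comp hF, Measure.volume_eq_prod]
  exact lintegral_prod_symm' (fun q : ℝ × ℝ => F !₂[q.1, q.2])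
    (hF.comp measurePreserving_prod_plane.measurable)

/-- The vertical primitive as an integral over a quadrant; the point with coordinates `s`, `t` is
`!₂[s, t]`. -/
lemma primitive_eq_double (h : IsTest Ω φ) (x : Plane) :
    primitive 1 φ x = ∫ t in Iic (x 1), ∫ s in Iic (x 0), partialDeriv 0 φ !₂[s, t] := by
  refine integral_congr_ae (Eventually.of_forall fun t => ?_)
  simp only
  rw [← h.primitive_partialDeriv 0 (coordLine 1 x t)]
  unfold primitive
  rw [coordLine_apply_of_ne (by decide)]
  refine integral_congr_ae (Eventually.of_forall fun s => ?_)
  simp only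
  congr 1
  ext k
  fin_cases k <;> simp [coordLine]

lemma primitive_zero_eq_double (h : IsTest Ω φ) (x : Plane) :
    primitive 0 φ x = ∫ s in Iic (x 0), ∫ t in Iic (x 1), partialDeriv 1 φ !₂[s, t] := by
  refine integral_congr_ae (Eventually.of_forall fun s => ?_)
  simp only
  rw [← h.primitive_partialDeriv 1 (coordLine 0 x s)]
  unfold primitive
  rw [coordLine_apply_of_ne (by decide)]
  refine integral_congr_ae (Eventually.of_forall fun t => ?_)
  simp only
  congr 1
  ext k
  fin_cases k <;> simp [coordLine]

lemma IsTest.integrable_prod (h : IsTest Ω φ) :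
    Integrable (fun q : ℝ × ℝ => φ !₂[q.1, q.2]) (volume.prod volume) :=
  measurePreserving_prod_plane.integrable_comp_of_integrable h.integrable

/-- The vertical primitive of `φ` and minus the horizontal primitive of `θ` differ by at most the
`L¹` norm of the divergence of `(φ, θ)`. -/
lemma enorm_primitive_add_primitive_le (hφ : IsTest Ω φ) (hθ : IsTest Ω θ) (x : Plane) :
    ‖primitive 1 φ x + primitive 0 θ x‖ₑ ≤
      ∫⁻ y, ‖partialDeriv 0 φ y + partialDeriv 1 θ y‖ₑ := by
  have h0 := hφ.isTest_partialDeriv 0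
  have h1 := hθ.isTest_partialDeriv 1
  have hd := h0.add h1
  have hres : ∀ {η : Plane → ℝ}, IsTest Ω η → Integrable (fun q : ℝ × ℝ => η !₂[q.2, q.1])
      ((volume.restrict (Iic (x 1))).prod (volume.restrict (Iic (x 0)))) := fun h => by
    rw [Measure.prod_restrict]
    exact h.integrable_prod.swap.integrableOn
  have hsum : primitive 1 φ x + primitive 0 θ x = ∫ t in Iic (x 1), ∫ s in Iic (x 0),
      (partialDeriv 0 φ + partialDeriv 1 θ) !₂[s, t] := by
    rw [primitive_eq_double hφ, primitive_zero_eq_double hθ,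
      integral_integral_swap (f := fun s t => partialDeriv 1 θ !₂[s, t]) (hres h1).swap,
      ← integral_integral_add (hres h0) (hres h1)]
    rfl
  rw [hsum, lintegral_plane (F := fun y => ‖partialDeriv 0 φ y + partialDeriv 1 θ y‖ₑ)
    (h0.continuous.add h1.continuous).measurable.enorm]
  refine (enorm_integral_le_lintegral_enorm _).trans ?_
  refine (setLIntegral_le_lintegral _ _).trans (lintegral_mono fun t => ?_)
  exact (enorm_integral_le_lintegral_enorm _).trans (setLIntegral_le_lintegral _ _)

lemma enorm_primitive_le (hφ : IsTest Ω φ) (x : Plane) :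
    ‖primitive 1 φ x‖ₑ ≤ ∫⁻ y, ‖partialDeriv 0 φ y‖ₑ := by
  have h := enorm_primitive_add_primitive_le hφ isTest_zero x
  have h1 : primitive 0 (0 : Plane → ℝ) x = 0 := by simp [primitive]
  have h2 : ∀ y, partialDeriv 1 (0 : Plane → ℝ) y = 0 := fun y => by simp [partialDeriv]
  simpa [h1, h2] using h

/-! ### The complement of a simply connected open set has no compact pieces -/

/-- The complex number `(x₀ - p₀) + i (x₁ - p₁)`. -/
def toComplex (p x : Plane) : ℂ := ⟨x 0 - p 0, x 1 - p 1⟩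

lemma continuous_toComplex (p : Plane) : Continuous (toComplex p) := by
  have : toComplex p = fun x => ((x 0 - p 0 : ℝ) : ℂ) + ((x 1 - p 1 : ℝ) : ℂ) * Complex.I := by
    funext x; apply Complex.ext <;> simp [toComplex]
  rw [this]
  fun_prop

lemma toComplex_ne_zero {p x : Plane} (h : x ≠ p) : toComplex p x ≠ 0 := by
  intro h0
  have h1 := congrArg Complex.re h0
  have h2 := congrArg Complex.im h0
  simp [toComplex] at h1 h2
  apply h
  ext i
  fin_cases i
  · simpa using sub_eq_zero.1 h1
  · simpa using sub_eq_zero.1 h2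

/-- There is no continuous logarithm of `x - p` on the complement of a compact set. -/
lemma not_exists_log_off_compact {A : Set Plane} (hA : IsCompact A) (p : Plane) :
    ¬ ∃ L : Plane → ℂ, ContinuousOn L Aᶜ ∧ ∀ x ∈ Aᶜ, Complex.exp (L x) = toComplex p x := by
  rintro ⟨L, hL, hexp⟩
  obtain ⟨R, hR0, hR⟩ := hA.isBounded.subset_ball_lt 0 p
  let γ : ℝ → Plane := fun t => p + !₂[R * Real.cos t, R * Real.sin t]
  have hγc : Continuous γ := by
    refine continuous_const.add ((PiLp.continuous_toLp 2 _).comp (continuous_pi fun i => ?_))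
    fin_cases i
    · simp only [Fin.zero_eta, Matrix.cons_val_zero]; fun_prop
    · simp only [Fin.mk_one, Matrix.cons_val_one]; fun_prop
  have hγA : ∀ t, γ t ∈ Aᶜ := fun t ht => by
    have h1 := hR ht
    rw [mem_ball_iff_norm] at h1
    have h2 : ‖γ t - p‖ ^ 2 = R ^ 2 := by
      rw [EuclideanSpace.norm_sq_eq]
      simp only [γ, add_sub_cancel_left, Fin.sum_univ_two, Real.norm_eq_abs, sq_abs]
      simp
      have := Real.sin_sq_add_cos_sq t
      linear_combination R ^ 2 * this
    have h3 := norm_nonneg (γ t - p)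
    nlinarith
  have hz : ∀ t, toComplex p (γ t) = R * Complex.exp (t * Complex.I) := fun t => by
    apply Complex.ext
    · simp [toComplex, γ, Complex.exp_re, Complex.exp_im]
    · simp [toComplex, γ, Complex.exp_re, Complex.exp_im]
  -- Along the circle the logarithm is `log R + t * I` up to a constant, which is not periodic.
  let k : ℝ → ℂ := fun t => L (γ t) - t * Complex.I
  have hk : Continuous k := by
    refine Continuous.sub (hL.comp_continuous hγc hγA) ?_
    fun_prop
  have hkexp : ∀ t, Complex.exp (k t) = R := fun t => by
    simp only [k]
    rw [Complex.exp_sub, hexp _ (hγA t), hz, mul_div_assoc,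
      div_self (Complex.exp_ne_zero _), mul_one]
  have hconst : k = fun _ => k 0 :=
    Complex.isCoveringMap_exp.eq_of_comp_eq hk continuous_const
      (by funext t; simp only [Function.comp, hkexp]) 0 rfl
  have h2 := congrFun hconst (2 * Real.pi)
  have hγ2 : γ (2 * Real.pi) = γ 0 := by simp [γ]
  simp only [k, hγ2] at h2
  have h3 := congrArg Complex.im h2
  simp at h3

/-- If the complement of a simply connected open subset of the plane is the disjoint union of a
compact set `A` and a closed set `B`, then `A` is empty. A logarithm of `x - p` on `Ω`, for a point
`p` of `A`, would extend across `B`: cut off near `A` and `B`, it describes `x - p` as a transition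
function on `Ω`, and such a transition function splits because the plane is simply connected. -/
lemma eq_empty_of_isCompact_of_compl (hΩ : IsOpen Ω) (hsc : IsSimplyConnected Ω) {A B : Set Plane}
    (hA : IsCompact A) (hB : IsClosed B) (hAB : Disjoint A B) (hcov : A ∪ B = Ωᶜ) : A = ∅ := by
  by_contra hne
  obtain ⟨p, hp⟩ := nonempty_iff_ne_empty.2 hne
  have hmem : ∀ x, x ∈ Ω ↔ x ∉ A ∧ x ∉ B := fun x => by
    have : x ∈ A ∪ B ↔ x ∈ Ωᶜ := by rw [hcov]
    simp at this
    tauto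
  obtain ⟨f, hfc, hf⟩ := Complex.exists_continuousOn_eqOn_exp_comp hsc hΩ
    (continuous_toComplex p).continuousOn (by
      rintro ⟨x, hx, h0⟩
      exact toComplex_ne_zero (fun h : x = p => ((hmem x).1 hx).1 (h ▸ hp)) h0)
  obtain ⟨w, hw0, hw1, -⟩ := exists_continuous_zero_one_of_isClosed hA.isClosed hB hAB
  -- `χ` is `1` in a neighbourhood of `A` and `0` in a neighbourhood of `B`, so that `(1 - χ) f`
  -- extends continuously by zero to `A`, and `χ f` to `B`.
  let χ : Plane → ℝ := fun x => max 0 (min 1 (2 - 3 * w x))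
  have hχ : Continuous χ := by fun_prop
  have hχA : ∀ x, w x < 1 / 3 → χ x = 1 := fun x hx => by
    simp only [χ]; rw [min_eq_left (by linarith), max_eq_right zero_le_one]
  have hχB : ∀ x, 2 / 3 < w x → χ x = 0 := fun x hx => by
    simp only [χ]; rw [max_eq_left ((min_le_right _ _).trans (by linarith))]
  have hVA : ∀ x ∈ A, ∀ᶠ y in 𝓝 x, w y < 1 / 3 := fun x hx =>
    w.continuous.continuousAt.eventually_lt continuousAt_const (by rw [hw0 hx]; norm_num)
  have hVB : ∀ x ∈ B, ∀ᶠ y in 𝓝 x, 2 / 3 < w y := fun x hx =>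
    continuousAt_const.eventually_lt w.continuous.continuousAt (by rw [hw1 hx]; norm_num)
  let F₁ : Plane → ℂ := fun x => ((1 - χ x : ℝ) : ℂ) * Ω.indicator f x
  let F₂ : Plane → ℂ := fun x => ((χ x : ℝ) : ℂ) * Ω.indicator f x
  have hfΩ : ∀ x ∈ Ω, ContinuousAt (Ω.indicator f) x := fun x hx => by
    refine (hfc.continuousAt (hΩ.mem_nhds hx)).congr ?_
    filter_upwards [hΩ.mem_nhds hx] with y hy
    rw [indicator_of_mem hy]
  have hF₁ : ∀ x, x ∉ B → ContinuousAt F₁ x := fun x hx => by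
    by_cases hxA : x ∈ A
    · refine (continuousAt_const (y := (0 : ℂ))).congr ?_
      filter_upwards [hVA x hxA] with y hy
      simp [F₁, hχA y hy]
    · exact (Complex.continuous_ofReal.comp (continuous_const.sub hχ)).continuousAt.mul
        (hfΩ x ((hmem x).2 ⟨hxA, hx⟩))
  have hF₂ : ∀ x, x ∉ A → ContinuousAt F₂ x := fun x hx => by
    by_cases hxB : x ∈ B
    · refine (continuousAt_const (y := (0 : ℂ))).congr ?_
      filter_upwards [hVB x hxB] with y hy
      simp [F₂, hχB y hy]
    · exact (Complex.continuous_ofReal.comp hχ).continuousAt.mul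
        (hfΩ x ((hmem x).2 ⟨hx, hxB⟩))
  have hglue : ∀ x ∈ Ω, Complex.exp (F₁ x) = toComplex p x * Complex.exp (-F₂ x) := fun x hx => by
    have h1 : F₁ x = f x + -F₂ x := by
      simp only [F₁, F₂, indicator_of_mem hx]; push_cast; ring
    rw [h1, Complex.exp_add]
    congr 1
    exact hf hx
  classical
  let G : Plane → ℂ := fun x =>
    if x ∈ B then toComplex p x * Complex.exp (-F₂ x) else Complex.exp (F₁ x)
  have hGA : ∀ x, x ∉ A → G x = toComplex p x * Complex.exp (-F₂ x) := fun x hx => by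
    by_cases hxB : x ∈ B
    · simp only [G, if_pos hxB]
    · simp only [G, if_neg hxB]; exact hglue x ((hmem x).2 ⟨hx, hxB⟩)
  have hGc : Continuous G := continuous_iff_continuousAt.2 fun x => by
    by_cases hxB : x ∈ B
    · have hxA : x ∉ A := fun h => hAB.le_bot ⟨h, hxB⟩
      refine ((continuous_toComplex p).continuousAt.mul (hF₂ x hxA).neg.cexp).congr ?_
      filter_upwards [hA.isClosed.isOpen_compl.mem_nhds hxA] with y hy
      exact (hGA y hy).symm
    · refine (hF₁ x hxB).cexp.congr ?_
      filter_upwards [hB.isOpen_compl.mem_nhds hxB] with y hy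
      simp only [G, if_neg (show y ∉ B from hy)]
  have hG0 : ∀ x, G x ≠ 0 := fun x => by
    by_cases hxB : x ∈ B
    · simp only [G, if_pos hxB]
      exact mul_ne_zero (toComplex_ne_zero fun h => hAB.le_bot ⟨hp, h ▸ hxB⟩)
        (Complex.exp_ne_zero _)
    · simp only [G, if_neg hxB]; exact Complex.exp_ne_zero _
  have huniv : IsSimplyConnected (univ : Set Plane) := by
    have : ContractibleSpace (univ : Set Plane) :=
      (convex_univ (𝕜 := ℝ)).contractibleSpace univ_nonempty
    exact SimplyConnectedSpace.ofContractible _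
  obtain ⟨h, hhc, hh⟩ := Complex.exists_continuousOn_eqOn_exp_comp huniv isOpen_univ
    hGc.continuousOn (by rintro ⟨x, -, h0⟩; exact hG0 x h0)
  refine not_exists_log_off_compact hA p ⟨fun x => h x + F₂ x, ?_, fun x hx => ?_⟩
  · intro x hx
    exact ((hhc.continuousAt univ_mem).add (hF₂ x hx)).continuousWithinAt
  · have h1 : Complex.exp (h x) = G x := hh (mem_univ x)
    rw [Complex.exp_add, h1, hGA x hx, mul_assoc, ← Complex.exp_add, neg_add_cancel,
      Complex.exp_zero, mul_one]

/-! ### Multiplication by smooth functions with bounded derivatives -/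

/-- The iterated partial derivative of `φ` in the directions listed in `l`. -/
def iterPartial : List (Fin 2) → (Plane → ℝ) → Plane → ℝ
  | [], φ => φ
  | i :: l, φ => iterPartial l (partialDeriv i φ)

/-- Smooth functions all of whose derivatives are bounded. -/
def IsBoundedSmooth (χ : Plane → ℝ) : Prop :=
  ContDiff ℝ ∞ χ ∧ ∀ l, ∃ C : ℝ, ∀ x, |iterPartial l χ x| ≤ C

lemma IsBoundedSmooth.isBoundedSmooth_partialDeriv {χ : Plane → ℝ} (h : IsBoundedSmooth χ)
    (i : Fin 2) : IsBoundedSmooth (partialDeriv i χ) :=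
  ⟨contDiff_partialDeriv i h.1, fun l => h.2 (i :: l)⟩

lemma IsTest.isTest_iterPartial : ∀ (l : List (Fin 2)) {φ : Plane → ℝ}, IsTest Ω φ →
    IsTest Ω (iterPartial l φ)
  | [], _, h => h
  | i :: l, _, h => (h.isTest_partialDeriv i).isTest_iterPartial l

lemma IsTest.exists_bound (h : IsTest Ω φ) : ∃ C : ℝ, ∀ x, |φ x| ≤ C := by
  obtain ⟨C, hC⟩ := h.2.1.exists_bound_of_continuous h.continuous
  exact ⟨C, hC⟩

lemma IsTest.isBoundedSmooth (h : IsTest Ω φ) : IsBoundedSmooth φ :=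
  ⟨h.1, fun l => (h.isTest_iterPartial l).exists_bound⟩

lemma MemH.of_succ : ∀ {k : ℕ} {f : Plane → ℝ}, MemH Ω (k + 1) f → MemH Ω k f
  | 0, _, h => h.1
  | _ + 1, _, h => ⟨h.1, fun i => ⟨(h.2 i).1, (h.2 i).2.of_succ⟩⟩

lemma IsBoundedSmooth.memH_mul (hΩ : IsOpen Ω) : ∀ {k : ℕ} {χ f : Plane → ℝ},
    IsBoundedSmooth χ → MemH Ω k f → MemH Ω k (χ * f) := by
  have base : ∀ {χ f : Plane → ℝ}, IsBoundedSmooth χ → MemLp f 2 (volume.restrict Ω) →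
      MemLp (χ * f) 2 (volume.restrict Ω) := fun {χ f} hχ hf => by
    obtain ⟨C, hC⟩ := hχ.2 []
    refine hf.of_le_mul (c := C) (hχ.1.continuous.aestronglyMeasurable.mul hf.1)
      (Eventually.of_forall fun x => ?_)
    rw [Pi.mul_apply, norm_mul]
    exact mul_le_mul_of_nonneg_right (hC x) (norm_nonneg _)
  intro k
  induction k with
  | zero => exact base
  | succ k ih =>
    intro χ f hχ hf
    rw [memH_succ_iff hΩ fun i => (hf.hasWeakPartial i).smooth_mul hΩ hχ.1]
    exact ⟨base hχ hf.1, fun i => (ih (hχ.isBoundedSmooth_partialDeriv i) hf.of_succ).add hΩ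
      (ih hχ (hf.2 i).2)⟩

/-- Sequences of smooth multipliers with uniformly bounded derivatives, which tend to zero
pointwise together with all derivatives. -/
def IsVanishingMultiplier (χ : ℕ → Plane → ℝ) : Prop :=
  (∀ n, ContDiff ℝ ∞ (χ n)) ∧ ∀ l, (∃ C : ℝ, ∀ n x, |iterPartial l (χ n) x| ≤ C) ∧
    ∀ x, Tendsto (fun n => iterPartial l (χ n) x) atTop (𝓝 0)

lemma IsVanishingMultiplier.isBoundedSmooth {χ : ℕ → Plane → ℝ} (h : IsVanishingMultiplier χ)
    (n : ℕ) : IsBoundedSmooth (χ n) :=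
  ⟨h.1 n, fun l => (h.2 l).1.imp fun _ hC => hC n⟩

lemma IsVanishingMultiplier.isVanishingMultiplier_partialDeriv {χ : ℕ → Plane → ℝ}
    (h : IsVanishingMultiplier χ) (i : Fin 2) :
    IsVanishingMultiplier (fun n => partialDeriv i (χ n)) :=
  ⟨fun n => contDiff_partialDeriv i (h.1 n), fun l => h.2 (i :: l)⟩

lemma eLpNorm_two_sq {α : Type*} [MeasurableSpace α] (f : α → ℝ) (μ : Measure α) :
    eLpNorm f 2 μ ^ 2 = ∫⁻ x, ‖f x‖ₑ ^ 2 ∂μ := by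
  have := eLpNorm_nnreal_pow_eq_lintegral (μ := μ) (f := f) (p := 2) (by norm_num)
  norm_num at this
  exact_mod_cast this

lemma IsVanishingMultiplier.tendsto_eLpNorm {χ : ℕ → Plane → ℝ} (h : IsVanishingMultiplier χ)
    {μ : Measure Plane} (hf : MemLp f 2 μ) :
    Tendsto (fun n => eLpNorm (χ n * f) 2 μ ^ 2) atTop (𝓝 0) := by
  obtain ⟨⟨C, hC⟩, hlim⟩ := h.2 []
  simp only [iterPartial] at hC hlim
  simp_rw [eLpNorm_two_sq]
  have h0 : ∫⁻ _, (0 : ℝ≥0∞) ∂μ = 0 := by simp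
  rw [← h0]
  refine tendsto_lintegral_of_dominated_convergence' (fun x => ‖C * f x‖ₑ ^ 2) ?_ ?_ ?_ ?_
  · exact fun n => (((h.1 n).continuous.aestronglyMeasurable.mul hf.1).enorm).pow_const 2
  · refine fun n => Eventually.of_forall fun x => pow_le_pow_left' ?_ 2
    rw [Pi.mul_apply, enorm_mul, enorm_mul]
    gcongr
    rw [enorm_le_iff_norm_le]
    exact (hC n x).trans (le_abs_self C)
  · have := (hf.const_mul C).eLpNorm_ne_top
    rw [← eLpNorm_two_sq]
    exact ENNReal.pow_ne_top this
  · refine Eventually.of_forall fun x => ?_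
    have h1 : Tendsto (fun n => χ n x * f x) atTop (𝓝 0) := by
      simpa using (hlim x).mul_const (f x)
    have h2 := ((ENNReal.continuous_pow 2).tendsto _).comp h1.enorm
    simpa [Function.comp_def] using h2

/-- Dominated convergence for products with vanishing multipliers. The induction on `k` works since
the derivatives of a vanishing multiplier form vanishing multipliers. -/
lemma IsVanishingMultiplier.tendsto_normSqH (hΩ : IsOpen Ω) : ∀ {k : ℕ} {χ : ℕ → Plane → ℝ}
    {f : Plane → ℝ}, IsVanishingMultiplier χ → MemH Ω k f →
    Tendsto (fun n => normSqH Ω k (χ n * f)) atTop (𝓝 0) := by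
  intro k
  induction k with
  | zero => exact fun h hf => h.tendsto_eLpNorm hf
  | succ k ih =>
    intro χ f h hf
    have hsum : Tendsto (fun n => eLpNorm (χ n * f) 2 (volume.restrict Ω) ^ 2 +
        ∑ i, 2 * (normSqH Ω k (partialDeriv i (χ n) * f) +
          normSqH Ω k (χ n * weakPartial Ω i f))) atTop (𝓝 (0 + ∑ i : Fin 2, 2 * (0 + 0))) := by
      refine (h.tendsto_eLpNorm hf.1).add (tendsto_finsetSum _ fun i _ => ?_)
      exact ENNReal.Tendsto.const_mul ((ih (h.isVanishingMultiplier_partialDeriv i) hf.of_succ).add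
        (ih h (hf.2 i).2)) (Or.inr (by norm_num))
    simp only [add_zero, mul_zero, Finset.sum_const_zero] at hsum
    refine tendsto_of_tendsto_of_tendsto_of_le_of_le tendsto_const_nhds hsum
      (fun _ => zero_le) fun n => ?_
    dsimp only
    rw [normSqH_succ hΩ fun i => (hf.hasWeakPartial i).smooth_mul hΩ (h.1 n)]
    gcongr with i
    exact normSqH_add_le hΩ
      (((h.isBoundedSmooth n).isBoundedSmooth_partialDeriv i).memH_mul hΩ hf.of_succ)
      ((h.isBoundedSmooth n).memH_mul hΩ (hf.2 i).2)

lemma iterPartial_scale (a c : ℝ) : ∀ (l : List (Fin 2)) {φ : Plane → ℝ}, IsTest univ φ →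
    iterPartial l (fun x => a * φ (c • x)) = fun x => a * c ^ l.length * iterPartial l φ (c • x)
  | [], φ, _ => by simp [iterPartial]
  | i :: l, φ, h => by
    have : partialDeriv i (fun x => a * φ (c • x)) =
        fun x => (a * c) * partialDeriv i φ (c • x) := by
      funext x
      unfold partialDeriv
      have h1 : HasFDerivAt (fun x : Plane => φ (c • x))
          ((fderiv ℝ φ (c • x)).comp (c • ContinuousLinearMap.id ℝ Plane)) x :=
        (h.differentiable (c • x)).hasFDerivAt.comp x ((hasFDerivAt_id x).const_smul c)
      rw [(h1.const_mul a).fderiv]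
      simp
      ring
    rw [iterPartial, this, iterPartial_scale (a * c) c l (h.isTest_partialDeriv i)]
    funext x
    simp only [iterPartial, List.length_cons, pow_succ]
    ring

/-- Smooth cutoffs at infinity: `ζ n` has compact support and `1 - ζ n` is a vanishing
multiplier. -/
lemma exists_cutoff : ∃ ζ : ℕ → Plane → ℝ, (∀ n, IsTest univ (ζ n)) ∧
    IsVanishingMultiplier (fun n => 1 - ζ n) := by
  let b : ContDiffBump (0 : Plane) := ⟨1, 2, one_pos, one_lt_two⟩
  have hb : IsTest univ b := ⟨b.contDiff, b.hasCompactSupport, subset_univ _⟩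
  let c : ℕ → ℝ := fun n => 1 / ((n : ℝ) + 1)
  have hc0 : ∀ n, 0 < c n := fun n => by positivity
  have hc1 : ∀ n, c n ≤ 1 := fun n => by
    simp only [c]; rw [div_le_one (by positivity)]; linarith [(Nat.cast_nonneg n : (0 : ℝ) ≤ n)]
  have hclim : Tendsto c atTop (𝓝 0) := tendsto_one_div_add_atTop_nhds_zero_nat
  let ζ : ℕ → Plane → ℝ := fun n x => b (c n • x)
  have hsm : ∀ n, ContDiff ℝ ∞ (ζ n) := fun n => b.contDiff.comp (contDiff_const_smul (c n))
  have hζ : ∀ n, IsTest univ (ζ n) := fun n =>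
    ⟨hsm n, b.hasCompactSupport.comp_homeomorph (Homeomorph.smulOfNeZero (c n) (hc0 n).ne'),
      subset_univ _⟩
  refine ⟨ζ, hζ, fun n => contDiff_const.sub (hsm n), fun l => ?_⟩
  cases l with
  | nil =>
    refine ⟨⟨1, fun n x => ?_⟩, fun x => ?_⟩
    · simp only [iterPartial, Pi.sub_apply, Pi.one_apply, ζ]
      rw [abs_le]
      constructor <;> linarith [b.nonneg (x := c n • x), b.le_one (x := c n • x)]
    · have h1 : Tendsto (fun n => c n • x) atTop (𝓝 0) := by
        simpa using hclim.smul_const x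
      have h2 := (b.continuous.tendsto 0).comp h1
      have h3 := h2.const_sub 1
      rw [b.one_of_mem_closedBall (by simp [b])] at h3
      simpa [iterPartial, ζ] using h3
  | cons i l =>
    have hd : ∀ n, iterPartial (i :: l) (1 - ζ n) = fun x => c n * c n ^ l.length *
        iterPartial l (-partialDeriv i b) (c n • x) := fun n => by
      rw [iterPartial, ← iterPartial_scale (c n) (c n) l (hb.isTest_partialDeriv i).neg]
      congr 1
      rw [partialDeriv_sub i (by exact differentiable_const _) (hζ n).differentiable]
      have h1 := iterPartial_scale 1 (c n) [i] hb
      simp only [iterPartial, one_mul, List.length_singleton, pow_one] at h1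
      funext x
      have h2 := congrFun h1 x
      have h3 : partialDeriv i (1 : Plane → ℝ) x = 0 := by
        simp [partialDeriv]
      simp only [Pi.sub_apply, h3, ζ, h2, Pi.neg_apply]
      ring
    obtain ⟨C, hC⟩ := ((hb.isTest_partialDeriv i).neg.isTest_iterPartial l).exists_bound
    have hC0 : 0 ≤ C := (abs_nonneg _).trans (hC 0)
    have hle : ∀ n x, |iterPartial (i :: l) (1 - ζ n) x| ≤ c n * C := fun n x => by
      rw [hd n, abs_mul, abs_of_nonneg (by have := hc0 n; positivity)]
      refine mul_le_mul ?_ (hC _) (abs_nonneg _) (hc0 n).le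
      exact mul_le_of_le_one_right (hc0 n).le (pow_le_one₀ (hc0 n).le (hc1 n))
    refine ⟨⟨C, fun n x => (hle n x).trans (mul_le_of_le_one_left hC0 (hc1 n))⟩, fun x => ?_⟩
    refine squeeze_zero_norm (fun n => hle n x) ?_
    simpa using hclim.mul_const C

/-! ### Mollification -/

/-- A smooth compactly supported probability density; its support need not contain the origin. -/
structure IsKernel (ρ : Plane → ℝ) : Prop where
  isTest : IsTest univ ρ
  nonneg : ∀ x, 0 ≤ ρ x
  integral_eq_one : ∫ x, ρ x = 1

/-- The convolution of `f` with the kernel `ρ`. -/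
def mollify (ρ f : Plane → ℝ) : Plane → ℝ := ρ ⋆[ContinuousLinearMap.lsmul ℝ ℝ, volume] f

lemma mollify_apply (ρ f : Plane → ℝ) (x : Plane) : mollify ρ f x = ∫ z, ρ z * f (x - z) := rfl

lemma contDiff_mollify {ρ : Plane → ℝ} (hρ : IsTest univ ρ) (hf : LocallyIntegrable f volume) :
    ContDiff ℝ ∞ (mollify ρ f) :=
  hρ.2.1.contDiff_convolution_left (n := ⊤) _ hρ.1 hf

/-- The derivative can be put on the kernel, and from there, as a weak derivative, on `f`. -/
lemma partialDeriv_mollify {ρ w : Plane → ℝ} (hρ : IsTest univ ρ)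
    (h : HasWeakPartial univ i f w) : partialDeriv i (mollify ρ f) = mollify ρ w := by
  have hf : LocallyIntegrable f volume := locallyIntegrableOn_univ.1 h.1
  funext x
  have h1 := hρ.2.1.hasFDerivAt_convolution_left (ContinuousLinearMap.lsmul ℝ ℝ)
    (hρ.1.of_le (by exact_mod_cast le_top)) hf x
  unfold partialDeriv mollify
  rw [h1.fderiv, convolution_eq_swap, convolution_eq_swap]
  have hT : IsTest univ (fun y => ρ (x - y)) := by
    refine ⟨hρ.1.comp (contDiff_const.sub contDiff_id), ?_, subset_univ _⟩
    exact hρ.2.1.comp_homeomorph (Homeomorph.subLeft x)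
  have e := (hasWeakPartial_iff.1 h).2.2 _ hT
  have hd : ∀ y, partialDeriv i (fun y => ρ (x - y)) y = -partialDeriv i ρ (x - y) := fun y => by
    have h2 : HasFDerivAt (fun y => ρ (x - y))
        ((fderiv ℝ ρ (x - y)).comp (-ContinuousLinearMap.id ℝ Plane)) y :=
      (hρ.differentiable (x - y)).hasFDerivAt.comp y ((hasFDerivAt_id y).const_sub x)
    unfold partialDeriv
    rw [h2.fderiv]
    simp
  have hint := ((hρ.2.1.fderiv ℝ).convolutionExists_left
    (ContinuousLinearMap.precompL Plane (ContinuousLinearMap.lsmul ℝ ℝ : ℝ →L[ℝ] ℝ →L[ℝ] ℝ))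
    (hρ.1.continuous_fderiv (by simp)) hf x).integrable_swap
  rw [ContinuousLinearMap.integral_apply hint]
  simp_rw [hd, mul_neg, integral_neg, neg_inj] at e
  simp only [ContinuousLinearMap.precompL_apply, ContinuousLinearMap.lsmul_apply, smul_eq_mul]
  simp_rw [mul_comm (ρ _)]
  rw [← e]
  refine integral_congr_ae (Eventually.of_forall fun y => ?_)
  simp [partialDeriv, mul_comm]

lemma hasWeakPartial_mollify {ρ w : Plane → ℝ} (hρ : IsTest univ ρ)
    (h : HasWeakPartial univ i f w) : HasWeakPartial univ i (mollify ρ f) (mollify ρ w) := by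
  have hf : LocallyIntegrable f volume := locallyIntegrableOn_univ.1 h.1
  rw [← partialDeriv_mollify hρ h]
  exact hasWeakPartial_of_differentiable (differentiable_of_contDiff (contDiff_mollify hρ hf))
    (continuous_partialDeriv i (contDiff_mollify hρ hf))

/-- Translations act continuously on `L²`. -/
lemma exists_eLpNorm_sub_translate_le (hf : MemLp f 2 (volume : Measure Plane)) {δ : ℝ≥0∞}
    (hδ : 0 < δ) : ∃ r > 0, ∀ z ∈ Metric.closedBall (0 : Plane) r,
      eLpNorm (fun x => f x - f (x - z)) 2 volume ≤ δ := by
  let F := hf.toLp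
  have : Fact ((2 : ℝ≥0∞) ≠ ⊤) := ⟨by norm_num⟩
  have hcont : Continuous (fun z : Plane => DomAddAct.mk (-z) +ᵥ F) :=
    (DomAddAct.continuous_mk.comp continuous_neg).vadd continuous_const
  have h1 : Tendsto (fun z : Plane => edist F (DomAddAct.mk (-z) +ᵥ F)) (𝓝 0) (𝓝 0) := by
    have := (tendsto_const_nhds (x := F)).edist (hcont.tendsto 0)
    simpa using this
  have h2 := h1.eventually_lt_const hδ
  obtain ⟨r, hr, hball⟩ := Metric.nhds_basis_closedBall.eventually_iff.1 h2
  refine ⟨r, hr, fun z hz => le_of_eq_of_le ?_ (hball hz).le⟩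
  rw [DomAddAct.mk_vadd_toLp, Lp.edist_toLp_toLp]
  congr 1
  funext x
  simp [sub_eq_neg_add]

lemma IsKernel.lintegral_ofReal {ρ : Plane → ℝ} (hρ : IsKernel ρ) :
    ∫⁻ z, ENNReal.ofReal (ρ z) = 1 := by
  rw [← ofReal_integral_eq_lintegral_ofReal hρ.isTest.integrable
    (Eventually.of_forall hρ.nonneg), hρ.integral_eq_one, ENNReal.ofReal_one]

/-- Jensen's inequality for the average defining a mollification. -/
lemma IsKernel.enorm_sub_mollify_sq_le {ρ : Plane → ℝ} (hρ : IsKernel ρ) (hfm : Measurable f)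
    (hf : LocallyIntegrable f volume) (x : Plane) :
    ‖f x - mollify ρ f x‖ₑ ^ 2 ≤ ∫⁻ z, ENNReal.ofReal (ρ z) * ‖f x - f (x - z)‖ₑ ^ 2 := by
  have hρm : Measurable fun z => ENNReal.ofReal (ρ z) :=
    hρ.isTest.continuous.measurable.ennreal_ofReal
  have hDm : Measurable fun z => f x - f (x - z) :=
    measurable_const.sub (hfm.comp (measurable_const.sub measurable_id))
  let ν := (volume : Measure Plane).withDensity fun z => ENNReal.ofReal (ρ z)
  have hν : IsProbabilityMeasure ν := ⟨by
    simp only [ν, withDensity_apply _ MeasurableSet.univ, Measure.restrict_univ]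
    exact hρ.lintegral_ofReal⟩
  have hconv : ∀ F : Plane → ℝ≥0∞, Measurable F →
      ∫⁻ z, F z ∂ν = ∫⁻ z, ENNReal.ofReal (ρ z) * F z := fun F hF =>
    lintegral_withDensity_eq_lintegral_mul _ hρm hF
  have h1 : f x - mollify ρ f x = ∫ z, ρ z * (f x - f (x - z)) := by
    have i1 : Integrable (fun z => ρ z * f x) := hρ.isTest.integrable.mul_const _
    have i2 : Integrable (fun z => ρ z * f (x - z)) :=
      (hρ.isTest.2.1.convolutionExists_left (ContinuousLinearMap.lsmul ℝ ℝ)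
        hρ.isTest.continuous hf x)
    simp_rw [mul_sub]
    rw [integral_sub i1 i2, integral_mul_const, hρ.integral_eq_one, one_mul, mollify_apply]
  have h2 : ‖f x - mollify ρ f x‖ₑ ≤ eLpNorm (fun z => f x - f (x - z)) 1 ν := by
    rw [h1, eLpNorm_one_eq_lintegral_enorm, hconv _ hDm.enorm]
    refine (enorm_integral_le_lintegral_enorm _).trans (le_of_eq (lintegral_congr fun z => ?_))
    rw [enorm_mul, Real.enorm_of_nonneg (hρ.nonneg z)]
  calc _ ≤ eLpNorm (fun z => f x - f (x - z)) 2 ν ^ 2 :=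
        pow_le_pow_left' (h2.trans (eLpNorm_le_eLpNorm_of_exponent_le (by norm_num)
          hDm.aestronglyMeasurable)) 2
    _ = _ := by rw [eLpNorm_two_sq, hconv _ (hDm.enorm.pow_const 2)]

lemma IsKernel.eLpNorm_sub_mollify_le {ρ : Plane → ℝ} (hρ : IsKernel ρ)
    (hf : MemLp f 2 (volume : Measure Plane)) {r : ℝ} {δ : ℝ≥0∞}
    (hsupp : Function.support ρ ⊆ Metric.closedBall 0 r)
    (hδ : ∀ z ∈ Metric.closedBall (0 : Plane) r,
      eLpNorm (fun x => f x - f (x - z)) 2 volume ≤ δ) :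
    eLpNorm (f - mollify ρ f) 2 volume ≤ δ := by
  wlog hfm : Measurable f generalizing f
  · have hae := hf.1.ae_eq_mk
    have hm := hf.1.stronglyMeasurable_mk.measurable
    have h1 := this ((memLp_congr_ae hae).1 hf) (fun z hz => ?_) hm
    · refine le_of_eq_of_le (eLpNorm_congr_ae ?_) h1
      have : mollify ρ f = mollify ρ (hf.1.mk f) := convolution_congr _ (ae_eq_refl _) hae
      rw [this]
      exact hae.sub (ae_eq_refl _)
    · refine le_of_eq_of_le (eLpNorm_congr_ae ?_) (hδ z hz)
      have h2 := (measurePreserving_sub_right volume z).quasiMeasurePreserving.ae_eq_comp hae.symm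
      filter_upwards [hae, h2] with x a b
      rw [← a]; simp only [Function.comp] at b; rw [b]
  have hloc : LocallyIntegrable f volume := hf.locallyIntegrable (by norm_num)
  have hρm : Measurable fun z => ENNReal.ofReal (ρ z) :=
    hρ.isTest.continuous.measurable.ennreal_ofReal
  have hjoint : Measurable fun q : Plane × Plane =>
      ENNReal.ofReal (ρ q.2) * ‖f q.1 - f (q.1 - q.2)‖ₑ ^ 2 :=
    (hρm.comp measurable_snd).mul (((hfm.comp measurable_fst).sub
      (hfm.comp (measurable_fst.sub measurable_snd))).enorm.pow_const 2)
  have hsq : eLpNorm (f - mollify ρ f) 2 volume ^ 2 ≤ δ ^ 2 := by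
    rw [eLpNorm_two_sq]
    calc ∫⁻ x, ‖(f - mollify ρ f) x‖ₑ ^ 2
        ≤ ∫⁻ x, ∫⁻ z, ENNReal.ofReal (ρ z) * ‖f x - f (x - z)‖ₑ ^ 2 :=
          lintegral_mono fun x => hρ.enorm_sub_mollify_sq_le hfm hloc x
      _ = ∫⁻ z, ∫⁻ x, ENNReal.ofReal (ρ z) * ‖f x - f (x - z)‖ₑ ^ 2 :=
          lintegral_lintegral_swap hjoint.aemeasurable
      _ ≤ ∫⁻ z, ENNReal.ofReal (ρ z) * δ ^ 2 := lintegral_mono fun z => by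
          rw [lintegral_const_mul' _ _ ENNReal.ofReal_ne_top]
          by_cases hz : ρ z = 0
          · simp [hz]
          · gcongr
            rw [← eLpNorm_two_sq]
            exact pow_le_pow_left' (hδ z (hsupp hz)) 2
      _ = δ ^ 2 := by rw [lintegral_mul_const _ hρm, hρ.lintegral_ofReal, one_mul]
  exact (ENNReal.pow_le_pow_left_iff two_ne_zero).1 hsq

/-- Mollification with kernels concentrated near the origin converges in `H^k` of the plane. -/
lemma exists_normSqH_sub_mollify_lt : ∀ {k : ℕ} {f : Plane → ℝ}, MemH univ k f →
    ∀ {ε : ℝ≥0∞}, 0 < ε → ∃ r > 0, ∀ ρ, IsKernel ρ →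
      Function.support ρ ⊆ Metric.closedBall 0 r → normSqH univ k (f - mollify ρ f) ≤ ε := by
  have base : ∀ {f : Plane → ℝ}, MemLp f 2 (volume.restrict univ) → ∀ {ε : ℝ≥0∞}, 0 < ε →
      ∃ r > 0, ∀ ρ, IsKernel ρ → Function.support ρ ⊆ Metric.closedBall 0 r →
        eLpNorm (f - mollify ρ f) 2 (volume.restrict univ) ^ 2 ≤ ε := fun {f} hf {ε} hε => by
    rw [Measure.restrict_univ] at *
    obtain ⟨r, hr, h⟩ := exists_eLpNorm_sub_translate_le hf (δ := min 1 ε) (by positivity)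
    refine ⟨r, hr, fun ρ hρ hs => ?_⟩
    have h1 := hρ.eLpNorm_sub_mollify_le hf hs h
    calc _ ≤ (min 1 ε) ^ 2 := pow_le_pow_left' h1 2
      _ ≤ min 1 ε := pow_le_of_le_one (zero_le) (min_le_left _ _) two_ne_zero
      _ ≤ ε := min_le_right _ _
  intro k
  induction k with
  | zero => exact base
  | succ k ih =>
    intro f hf ε hε
    have hε' : 0 < ε / 3 := ENNReal.div_pos hε.ne' (by norm_num)
    obtain ⟨r, hr, h⟩ := base hf.1 hε'
    choose s hs h' using fun i => ih (hf.2 i).2 hε'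
    refine ⟨min r (min (s 0) (s 1)), lt_min hr (lt_min (hs 0) (hs 1)), fun ρ hρ hsupp => ?_⟩
    rw [normSqH_succ isOpen_univ fun i => (hf.hasWeakPartial i).sub
      (hasWeakPartial_mollify hρ.isTest (hf.hasWeakPartial i)), Fin.sum_univ_two]
    have hsub : ∀ {t}, min r (min (s 0) (s 1)) ≤ t →
      Function.support ρ ⊆ Metric.closedBall 0 t := fun ht =>
        hsupp.trans (Metric.closedBall_subset_closedBall ht)
    calc _ ≤ ε / 3 + (ε / 3 + ε / 3) := add_le_add (h ρ hρ (hsub (min_le_left _ _)))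
          (add_le_add (h' 0 ρ hρ (hsub ((min_le_right _ _).trans (min_le_left _ _))))
            (h' 1 ρ hρ (hsub ((min_le_right _ _).trans (min_le_right _ _)))))
      _ = ε := by rw [← add_assoc, ENNReal.add_thirds]

/-- Off-centre kernels: every ball carries a kernel. -/
lemma exists_isKernel (c : Plane) {r : ℝ} (hr : 0 < r) :
    ∃ ρ, IsKernel ρ ∧ tsupport ρ = Metric.closedBall c r := by
  let b : ContDiffBump c := ⟨r / 2, r, half_pos hr, half_lt_self hr⟩
  exact ⟨b.normed volume, ⟨⟨b.contDiff_normed, b.hasCompactSupport_normed, subset_univ _⟩,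
    b.nonneg_normed, b.integral_normed⟩, b.tsupport_normed_eq⟩

/-! ### Geometry of Lipschitz open sets -/

/-- In a chart, the points strictly below the graph are exterior points. -/
lemma notMem_closure_of_lt {U : Set Plane} (hU : IsOpen U) {T : Plane ≃ₗᵢ[ℝ] Plane} {L : ℝ≥0}
    {γ : ℝ → ℝ} (hγ : LipschitzWith L γ) (hΩ : ∀ x ∈ U, (x ∈ Ω ↔ γ (T x 0) < T x 1)) {x : Plane}
    (hx : x ∈ U) (hlt : T x 1 < γ (T x 0)) : x ∉ closure Ω := by
  intro hcl
  have hc : ∀ i : Fin 2, Continuous fun y : Plane => T y i := fun i => by fun_prop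
  have hopen : IsOpen (U ∩ {y | T y 1 < γ (T y 0)}) :=
    hU.inter (isOpen_lt (hc 1) (hγ.continuous.comp (hc 0)))
  obtain ⟨y, ⟨hyU, hy⟩, hyΩ⟩ := mem_closure_iff.1 hcl _ hopen ⟨hx, hlt⟩
  exact lt_asymm hy ((hΩ y hyU).1 hyΩ)

lemma abs_apply_le_norm (x : Plane) (i : Fin 2) : |x i| ≤ ‖x‖ := PiLp.norm_apply_le x i

lemma abs_sub_le_of_lipschitzWith {L : ℝ≥0} {γ : ℝ → ℝ} (hγ : LipschitzWith L γ) (a b : ℝ) :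
    |γ a - γ b| ≤ L * |a - b| := by
  simpa [Real.dist_eq] using hγ.dist_le_mul a b

/-- Near each point, a suitable small translation moves the closure of a Lipschitz open set into
its interior, with room proportional to the length of the translation. -/
lemma IsLipschitzOpen.exists_inward (hΩ : IsLipschitzOpen Ω) (p : Plane) :
    ∃ U : Set Plane, IsOpen U ∧ p ∈ U ∧ ∃ e : Plane, ∃ c : ℝ, 0 < c ∧ ∀ K, IsCompact K → K ⊆ U →
      ∃ ε₀ : ℝ, 0 < ε₀ ∧ ∀ ε, 0 < ε → ε < ε₀ → ∀ x ∈ K, x ∈ closure Ω →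
        Metric.closedBall (x + ε • e) (c * ε) ⊆ Ω := by
  by_cases hp : p ∈ Ω
  · refine ⟨Ω, hΩ.1, hp, 0, 1, one_pos, fun K hK hKU => ?_⟩
    obtain ⟨δ, hδ, h⟩ := hK.exists_cthickening_subset_open hΩ.1 hKU
    refine ⟨δ, hδ, fun ε _ hεδ x hx _ => ?_⟩
    rw [smul_zero, add_zero, one_mul]
    exact ((Metric.closedBall_subset_closedBall hεδ.le).trans
      (Metric.closedBall_subset_cthickening hx δ)).trans h
  by_cases hp' : p ∈ closure Ω
  swap
  · refine ⟨(closure Ω)ᶜ, isClosed_closure.isOpen_compl, hp', 0, 1, one_pos, fun K _ hKU => ?_⟩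
    exact ⟨1, one_pos, fun ε _ _ x hx hx' => absurd hx' (hKU hx)⟩
  obtain ⟨U, T, L, γ, hU, hpU, hγ, hchart⟩ := hΩ.2 p ⟨hp', by rwa [hΩ.1.interior_eq]⟩
  let e : Plane := T.symm (EuclideanSpace.single 1 1)
  have hTe : T e = EuclideanSpace.single 1 1 := by simp [e]
  have hen : ‖e‖ = 1 := by simp [e]
  -- The room `c` has to satisfy `c * (L + 1) < 1`, where `L` is the Lipschitz constant.
  let c : ℝ := 1 / (L + 2)
  have hL : (0 : ℝ) ≤ L := L.2
  have hc : 0 < c := by positivity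
  have hcL : c * (L + 2) = 1 := by simp only [c]; field_simp
  refine ⟨U, hU, hpU, e, c, hc, fun K hK hKU => ?_⟩
  obtain ⟨δ, hδ, h⟩ := hK.exists_cthickening_subset_open hU hKU
  refine ⟨δ / 2, half_pos hδ, fun ε hε hεδ x hx hxcl z hz => ?_⟩
  let w := z - (x + ε • e)
  have hw : ‖w‖ ≤ c * ε := mem_closedBall_iff_norm.1 hz
  have hzw : z = x + ε • e + w := by simp [w]
  have hzU : z ∈ U := by
    refine h (Metric.closedBall_subset_cthickening hx δ (mem_closedBall_iff_norm.2 ?_))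
    have : z - x = ε • e + w := by rw [hzw]; abel
    rw [this]
    refine (norm_add_le _ _).trans ?_
    rw [norm_smul, hen, Real.norm_eq_abs, abs_of_pos hε]
    nlinarith
  have hTw : ∀ i, |T w i| ≤ c * ε := fun i =>
    (abs_apply_le_norm _ i).trans (by rw [LinearIsometryEquiv.norm_map]; exact hw)
  have hTz : T z = T x + ε • EuclideanSpace.single 1 1 + T w := by
    rw [hzw, map_add, map_add, map_smul, hTe]
  have h0 : T z 0 = T x 0 + T w 0 := by rw [hTz]; simp
  have h1 : T z 1 = T x 1 + ε + T w 1 := by rw [hTz]; simp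
  have hgx : γ (T x 0) ≤ T x 1 := by
    by_contra! hlt
    exact notMem_closure_of_lt hU hγ hchart (hKU hx) hlt hxcl
  rw [hchart z hzU, h0, h1]
  have h2 := abs_sub_le_of_lipschitzWith hγ (T x 0 + T w 0) (T x 0)
  rw [add_sub_cancel_left] at h2
  have h3 := (abs_le.1 h2).2
  have h4 := mul_le_mul_of_nonneg_left (hTw 0) hL
  have h5 := (abs_le.1 (hTw 1)).1
  nlinarith

lemma eq_of_isPreconnected {ψ : Plane → ℝ} {S : Set Plane} (hS : IsPreconnected S)
    (h : ∀ x ∈ S, ∀ᶠ y in 𝓝 x, ψ y = ψ x) {x y : Plane} (hx : x ∈ S) (hy : y ∈ S) : ψ x = ψ y := by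
  refine hS.induction₂ (fun x y => ψ x = ψ y) (fun x hx => ?_)
    (fun _ _ _ _ _ _ h h' => h.trans h') (fun _ _ _ _ h => h.symm) hx hy
  filter_upwards [nhdsWithin_le_nhds (h x hx)] with y hy using hy.symm

/-- A continuous function which is locally constant on the exterior of a Lipschitz open set is
locally constant on its complement. -/
lemma IsLipschitzOpen.eventually_eq_of_exterior (hΩ : IsLipschitzOpen Ω) {ψ : Plane → ℝ}
    (hψ : Continuous ψ) (hloc : ∀ x ∉ closure Ω, ∀ᶠ y in 𝓝 x, ψ y = ψ x) {p : Plane}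
    (hp : p ∉ Ω) : ∀ᶠ y in 𝓝 p, y ∉ Ω → ψ y = ψ p := by
  by_cases hp' : p ∈ closure Ω
  swap
  · filter_upwards [hloc p hp'] with y hy _ using hy
  obtain ⟨U, T, L, γ, hU, hpU, hγ, hchart⟩ := hΩ.2 p ⟨hp', by rwa [hΩ.1.interior_eq]⟩
  let e : Plane := T.symm (EuclideanSpace.single 1 1)
  have hTe : T e = EuclideanSpace.single 1 1 := by simp [e]
  have hen : ‖e‖ = 1 := by simp [e]
  have hL : (0 : ℝ) ≤ L := L.2
  obtain ⟨s, hs, hball⟩ := Metric.isOpen_iff.1 hU p hpU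
  let η : ℝ := s / (4 * (L + 1))
  have hη : 0 < η := by positivity
  have hηL : η * (L + 1) = s / 4 := by simp only [η]; field_simp
  have hηs : η ≤ s / 4 := by nlinarith
  have hbelow : ∀ x ∈ U, T x 1 < γ (T x 0) → ∀ᶠ y in 𝓝 x, ψ y = ψ x := fun x hx hlt =>
    hloc x (notMem_closure_of_lt hU hγ hchart hx hlt)
  have hTt : ∀ (y : Plane) (t : ℝ), T (y - t • e) 0 = T y 0 ∧ T (y - t • e) 1 = T y 1 - t :=
    fun y t => by
      rw [map_sub, map_smul, hTe]
      simp
  have hle : ∀ x ∈ U, x ∉ Ω → T x 1 ≤ γ (T x 0) := fun x hx hxΩ => by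
    by_contra! hlt
    exact hxΩ ((hchart x hx).2 hlt)
  -- `ψ` is constant on a ball below the graph, and along the vertical segments reaching up from
  -- that ball to the points of the complement of `Ω` near `p`.
  let q : Plane := p - (3 * s / 4) • e
  have hW : ∀ z ∈ Metric.ball q η, ∀ᶠ y in 𝓝 z, ψ y = ψ z := fun z hz => by
    have hzq : ‖z - q‖ < η := mem_ball_iff_norm.1 hz
    refine hbelow z (hball (mem_ball_iff_norm.2 ?_)) ?_
    · have : z - p = (z - q) - (3 * s / 4) • e := by simp only [q]; abel
      rw [this]
      refine (norm_sub_le _ _).trans_lt ?_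
      rw [norm_smul, hen, Real.norm_eq_abs, abs_of_pos (by positivity)]
      linarith
    · have hT : ∀ i, |T z i - T q i| < η := fun i => by
        have := (abs_apply_le_norm (T (z - q)) i)
        rw [LinearIsometryEquiv.norm_map, map_sub] at this
        exact lt_of_le_of_lt this hzq
      have h0 := hT 0
      have h1 := (abs_lt.1 (hT 1)).2
      rw [(hTt p _).1] at h0
      rw [(hTt p _).2] at h1
      have h2 := abs_sub_le_of_lipschitzWith hγ (T z 0) (T p 0)
      have h3 := (abs_le.1 h2).1
      have h4 := mul_le_mul_of_nonneg_left h0.le hL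
      have h5 := hle p hpU hp
      nlinarith
  have hWconst : ∀ z ∈ Metric.ball q η, ψ z = ψ q := fun z hz =>
    eq_of_isPreconnected (convex_ball q η).isPreconnected hW hz (Metric.mem_ball_self hη)
  have key : ∀ y ∈ Metric.ball p η, y ∉ Ω → ψ y = ψ q := fun y hy hyΩ => by
    have hyp : ‖y - p‖ < η := mem_ball_iff_norm.1 hy
    have hyU : y ∈ U := hball (mem_ball_iff_norm.2 (by linarith))
    have hcont : Continuous fun t : ℝ => y - t • e := by fun_prop
    have hseg : ∀ x ∈ (fun t : ℝ => y - t • e) '' Ioc 0 (3 * s / 4), ∀ᶠ z in 𝓝 x, ψ z = ψ x := by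
      rintro _ ⟨t, ⟨ht0, ht1⟩, rfl⟩
      refine hbelow _ (hball (mem_ball_iff_norm.2 ?_)) ?_
      · have : y - t • e - p = (y - p) - t • e := by abel
        rw [this]
        refine (norm_sub_le _ _).trans_lt ?_
        rw [norm_smul, hen, Real.norm_eq_abs, abs_of_pos ht0]
        linarith
      · rw [(hTt y t).1, (hTt y t).2]
        linarith [hle y hyU hyΩ]
    have hpre := (isPreconnected_Ioc (a := (0 : ℝ)) (b := 3 * s / 4)).image _ hcont.continuousOn
    have hend : (3 * s / 4) ∈ Ioc (0 : ℝ) (3 * s / 4) := ⟨by positivity, le_rfl⟩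
    have hq : ψ (y - (3 * s / 4) • e) = ψ q := by
      refine hWconst _ (mem_ball_iff_norm.2 ?_)
      simpa [q] using hyp
    have hval : ∀ t ∈ Ioc (0 : ℝ) (3 * s / 4), ψ (y - t • e) = ψ q := fun t ht =>
      (eq_of_isPreconnected hpre hseg ⟨t, ht, rfl⟩ ⟨_, hend, rfl⟩).trans hq
    have hlim : Tendsto (fun t : ℝ => ψ (y - t • e)) (𝓝[>] 0) (𝓝 (ψ y)) := by
      have := (hψ.comp hcont).tendsto 0
      simp only [Function.comp, zero_smul, sub_zero] at this
      exact this.mono_left nhdsWithin_le_nhds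
    refine tendsto_nhds_unique hlim (tendsto_const_nhds.congr' ?_)
    filter_upwards [Ioc_mem_nhdsGT (show (0 : ℝ) < 3 * s / 4 by positivity)] with t ht
    exact (hval t ht).symm
  filter_upwards [Metric.ball_mem_nhds p hη] with y hy hyΩ
  rw [key y hy hyΩ, key p (Metric.mem_ball_self hη) hp]

/-! ### Functions vanishing off a Lipschitz open set -/

/-- Localization of an `H^k` function vanishing off `Ω` to a set where small multiples of `e` push
the closure of `Ω` into `Ω`. The approximating test functions are mollifications with kernels supported
in the balls with centre `t • e` and radius `c * t`. -/
lemma memH0_mul_of_inward (hΩ : IsOpen Ω) {k : ℕ} (hf : MemH univ k f)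
    (hf0 : ∀ x ∉ Ω, f x = 0) (hχ : IsTest univ θ) {e : Plane} {c ε₀ : ℝ} (hc : 0 < c)
    (hε₀ : 0 < ε₀) (h : ∀ ε, 0 < ε → ε < ε₀ → ∀ x ∈ tsupport θ, x ∈ closure Ω →
        Metric.closedBall (x + ε • e) (c * ε) ⊆ Ω) : MemH0 Ω k (θ * f) := by
  have hm : MemH univ k (θ * f) := hχ.isBoundedSmooth.memH_mul isOpen_univ hf
  refine ⟨hm.mono isOpen_univ hΩ (subset_univ _), fun ε hε => ?_⟩
  have hsupp : tsupport (θ * f) ⊆ tsupport θ ∩ closure Ω := by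
    refine subset_inter tsupport_mul_subset_left (closure_mono fun x hx => ?_)
    by_contra hxΩ
    exact hx (by simp [hf0 x hxΩ])
  obtain ⟨δ, hδ0, hδ⟩ := exists_between hε
  obtain ⟨r, hr, hmol⟩ := exists_normSqH_sub_mollify_lt hm hδ0
  -- For `t` below `r / (‖e‖ + c)` the kernel is supported in the ball of radius `r`.
  obtain ⟨t, ht0, ht⟩ := exists_between (show 0 < min ε₀ (r / (‖e‖ + c)) by positivity)
  obtain ⟨ρ, hρ, hρs⟩ := exists_isKernel (t • e) (mul_pos hc ht0)
  have htr : t * (‖e‖ + c) ≤ r := by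
    rw [← le_div_iff₀ (by positivity)]
    exact ht.le.trans (min_le_right _ _)
  have hρball : Function.support ρ ⊆ Metric.closedBall 0 r := by
    refine (subset_tsupport ρ).trans (hρs ▸ Metric.closedBall_subset_closedBall' ?_)
    rw [dist_zero_right, norm_smul, Real.norm_eq_abs, abs_of_pos ht0]
    linarith
  have hcs : HasCompactSupport (θ * f) := hχ.2.1.mul_right
  have hcsm : HasCompactSupport (mollify ρ (θ * f)) := hρ.isTest.2.1.convolution _ hcs
  have hT : IsTest Ω (mollify ρ (θ * f)) := by
    refine ⟨contDiff_mollify hρ.isTest ?_, hcsm, ?_⟩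
    · exact locallyIntegrableOn_univ.1 (locallyIntegrableOn_of_memLp (by norm_num) hm.memLp)
    · have h1 : Function.support (mollify ρ (θ * f)) ⊆ tsupport ρ + tsupport (θ * f) :=
        (support_convolution_subset _).trans
          (add_subset_add (subset_tsupport _) (subset_tsupport _))
      have h2 : tsupport (mollify ρ (θ * f)) ⊆ tsupport ρ + tsupport (θ * f) :=
        closure_minimal h1 (hρ.isTest.2.1.isCompact.add hcs.isCompact).isClosed
      intro y hy
      obtain ⟨z, hz, x, hx, rfl⟩ := h2 hy
      refine h t ht0 (ht.trans_le (min_le_left _ _)) x (hsupp hx).1 (hsupp hx).2 ?_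
      rw [hρs] at hz
      rw [mem_closedBall_iff_norm] at hz ⊢
      change ‖z + x - (x + t • e)‖ ≤ c * t
      rwa [add_comm z x, add_sub_add_left_eq_sub]
  refine ⟨_, hT, ?_⟩
  exact ((normSqH_mono isOpen_univ hΩ (subset_univ _)
    (hm.sub isOpen_univ (hT.memH isOpen_univ))).trans (hmol ρ hρ hρball)).trans_lt hδ

/-- A function in `H^k` of the plane which vanishes off a Lipschitz open set `Ω` belongs to
`H^k_0(Ω)`. -/
lemma IsLipschitzOpen.memH0_of_eq_zero (hΩ : IsLipschitzOpen Ω) {k : ℕ} (hf : MemH univ k f)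
    (hf0 : ∀ x ∉ Ω, f x = 0) : MemH0 Ω k f := by
  obtain ⟨ζ, hζ, hvan⟩ := exists_cutoff
  choose U hU hpU e c hc hin using hΩ.exists_inward
  obtain ⟨P, hP⟩ := SmoothPartitionOfUnity.exists_isSubordinate (modelWithCornersSelf ℝ Plane)
    (isClosed_univ (X := Plane)) U hU (fun x _ => mem_iUnion.2 ⟨x, hpU x⟩)
  have hPs : ∀ p, ContDiff ℝ ∞ (P p) := fun p => (P p).contMDiff.contDiff
  have hloc : ∀ n p, MemH0 Ω k ((⇑(P p) * ζ n) * f) := fun n p => by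
    have hT : IsTest univ (⇑(P p) * ζ n) := (hζ n).smooth_mul (hPs p)
    have hsub : tsupport (⇑(P p) * ζ n) ⊆ U p := tsupport_mul_subset_left.trans (hP p)
    obtain ⟨ε₀, hε₀, h⟩ := hin p _ hT.2.1 hsub
    exact memH0_mul_of_inward hΩ.1 hf hf0 hT (hc p) hε₀ h
  have hcut : ∀ n, MemH0 Ω k (ζ n * f) := fun n => by
    have hfin := P.locallyFinite.finite_nonempty_inter_compact (hζ n).2.1
    have hsum : ζ n * f = ∑ p ∈ hfin.toFinset, (⇑(P p) * ζ n) * f := by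
      funext x
      simp only [Finset.sum_apply, Pi.mul_apply]
      rw [← Finset.sum_mul, ← Finset.sum_mul]
      by_cases hx : ζ n x = 0
      · simp [hx]
      · rw [P.sum_finsupport' x (mem_univ x), one_mul]
        intro p hp
        rw [Set.Finite.mem_toFinset]
        exact ⟨x, (P.mem_finsupport x).1 hp, subset_tsupport _ hx⟩
    rw [hsum]
    exact Finset.sum_induction _ (MemH0 Ω k) (fun _ _ h h' => h.add hΩ.1 h')
      (isTest_zero.memH0 hΩ.1)
      fun p _ => hloc n p
  have hfΩ : MemH Ω k f := hf.mono isOpen_univ hΩ.1 (subset_univ _)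
  refine memH0_of_forall_approx hΩ.1 hfΩ fun ε hε => ?_
  obtain ⟨n, hn⟩ := ((hvan.tendsto_normSqH hΩ.1 hfΩ).eventually_lt_const hε).exists
  refine ⟨_, hcut n, ?_⟩
  convert hn using 2
  ring

/-! ### The stream function -/

/-- On a set of finite area the `L¹` norm is controlled by the `L²` norm. -/
lemma IsTest.lintegral_enorm_le (hφ : IsTest Ω φ) :
    ∫⁻ x, ‖φ x‖ₑ ≤ eLpNorm φ 2 (volume.restrict Ω) * volume Ω ^ (1 / 2 : ℝ) := by
  have h1 := eLpNorm_le_eLpNorm_mul_rpow_measure_univ (μ := volume.restrict Ω) (p := 1) (q := 2)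
    (by norm_num) (f := φ) hφ.continuous.aestronglyMeasurable
  rw [eLpNorm_one_eq_lintegral_enorm, Measure.restrict_apply_univ] at h1
  have h2 : ∫⁻ x in Ω, ‖φ x‖ₑ = ∫⁻ x, ‖φ x‖ₑ := by
    refine setLIntegral_eq_of_support_subset fun x hx => ?_
    by_contra hxΩ
    exact hx (by simp [hφ.eq_zero hxΩ])
  rw [h2] at h1
  convert h1 using 3
  norm_num

lemma MemH0.hasWeakPartial_indicator (hΩ : IsOpen Ω) (hf : MemH0 Ω 1 f) (i : Fin 2) :
    HasWeakPartial univ i (Ω.indicator f) (Ω.indicator (weakPartial Ω i f)) := by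
  have hext : ∀ {h : Plane → ℝ}, MemLp h 2 (volume.restrict Ω) →
      LocallyIntegrableOn (Ω.indicator h) univ := fun hh =>
    locallyIntegrableOn_of_memLp (p := 2) (by norm_num) (by
      rw [Measure.restrict_univ]; exact (memLp_indicator_iff_restrict hΩ.measurableSet).2 hh)
  have hw : MemLp (weakPartial Ω i f) 2 (volume.restrict Ω) := (hf.1.2 i).2
  rw [hasWeakPartial_iff]
  refine ⟨hext hf.1.memLp, hext hw, fun θ hθ => ?_⟩
  obtain ⟨φ, hφ, hlim⟩ := hf.exists_seq
  have hind : ∀ h k : Plane → ℝ, ∫ x, Ω.indicator h x * k x = ∫ x in Ω, k x * h x := fun h k => by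
    rw [← integral_indicator hΩ.measurableSet]
    refine integral_congr_ae (Eventually.of_forall fun x => ?_)
    by_cases hx : x ∈ Ω <;> simp [hx, mul_comm]
  rw [hind, hind]
  have l1 := tendsto_integral_mul_of_tendsto_eLpNorm ((hθ.isTest_partialDeriv i).memLp 2 _)
    (fun n => (hφ n).memLp 2 _) hf.1.memLp (tendsto_eLpNorm_of_normSqH hlim)
  have l2 := tendsto_integral_mul_of_tendsto_eLpNorm (hθ.memLp 2 _)
    (fun n => ((hφ n).isTest_partialDeriv i).memLp 2 _) hw (tendsto_eLpNorm_of_normSqH (k := 0)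
      (tendsto_normSqH_weakPartial hΩ (hf.1.hasWeakPartial i) hφ hlim))
  refine tendsto_nhds_unique l1 (l2.neg.congr fun n => ?_)
  have e := integral_mul_partialDeriv (hφ n).differentiable (hφ n).continuous
    ((hφ n).isTest_partialDeriv i).continuous hθ (i := i)
  rw [(hφ n).setIntegral_mul, ((hφ n).isTest_partialDeriv i).setIntegral_mul]
  simp_rw [mul_comm (partialDeriv i θ _), mul_comm (θ _)]
  rw [e]

lemma tendsto_integral_mul_of_tendstoUniformly {A : ℕ → Plane → ℝ} {ψ : Plane → ℝ}
    (hA : ∀ n, Continuous (A n)) (hψ : TendstoUniformly A ψ atTop) (hθ : IsTest Ω θ) :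
    Tendsto (fun n => ∫ x, A n x * θ x) atTop (𝓝 (∫ x, ψ x * θ x)) := by
  have hc : Continuous ψ := hψ.continuous (Frequently.of_forall hA)
  refine tendsto_integral_filter_of_dominated_convergence (fun x => (|ψ x| + 1) * |θ x|) ?_ ?_ ?_ ?_
  · exact Eventually.of_forall fun n => ((hA n).mul hθ.continuous).aestronglyMeasurable
  · filter_upwards [Metric.tendstoUniformly_iff.1 hψ 1 one_pos] with n hn
    refine Eventually.of_forall fun x => ?_
    rw [norm_mul]
    refine mul_le_mul_of_nonneg_right ?_ (norm_nonneg _)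
    have h1 := hn x
    rw [Real.dist_eq] at h1
    have h2 := abs_sub_abs_le_abs_sub (A n x) (ψ x)
    rw [abs_sub_comm] at h1
    rw [Real.norm_eq_abs]
    linarith
  · exact ((hc.abs.add continuous_const).mul hθ.continuous.abs).integrable_of_hasCompactSupport
      (hθ.2.1.norm.mul_left)
  · exact Eventually.of_forall fun x => (hψ.tendsto_at x).mul_const _

/-- A divergence free `H¹_0` field on an open set of finite area has a stream function on the whole
plane: a continuous function vanishing at infinity, locally constant on the exterior of the set,
whose perpendicular gradient is the extension of the field by zero. -/
lemma exists_stream_function (hΩ : IsOpen Ω) (harea : volume Ω < ⊤) {u : Plane → Plane}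
    (hu : MemH10Vec Ω u) (hdiv : IsDivFree Ω u) :
    ∃ ψ : Plane → ℝ, Continuous ψ ∧ Tendsto ψ (cocompact Plane) (𝓝 0) ∧
      (∀ x ∉ closure Ω, ∀ᶠ y in 𝓝 x, ψ y = ψ x) ∧
      HasWeakPartial univ 1 ψ (Ω.indicator fun x => u x 0) ∧
      HasWeakPartial univ 0 ψ (-Ω.indicator fun x => u x 1) := by
  choose φ hφ hlim using fun j => (hu j).exists_seq
  let κ : ℝ≥0∞ := volume Ω ^ (1 / 2 : ℝ)
  have hκ : κ ≠ ⊤ := ENNReal.rpow_ne_top_of_nonneg (by norm_num) harea.ne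
  have hw : ∀ i j, HasWeakPartial Ω i (fun x => u x j) (weakPartial Ω i fun x => u x j) :=
    fun i j => (hu j).1.hasWeakPartial i
  have hwm : ∀ i j, MemLp (weakPartial Ω i fun x => u x j) 2 (volume.restrict Ω) :=
    fun i j => ((hu j).1.2 i).2
  have hd : ∀ i j, Tendsto (fun n => eLpNorm ((weakPartial Ω i fun x => u x j) -
      partialDeriv i (φ j n)) 2 (volume.restrict Ω)) atTop (𝓝 0) := fun i j =>
    tendsto_eLpNorm_of_normSqH (k := 0) (tendsto_normSqH_weakPartial hΩ (hw i j) (hφ j) (hlim j))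
  have hsm : ∀ i j n, AEStronglyMeasurable ((weakPartial Ω i fun x => u x j) -
      partialDeriv i (φ j n)) (volume.restrict Ω) := fun i j n =>
    (hwm i j).1.sub ((hφ j n).isTest_partialDeriv i).continuous.aestronglyMeasurable
  let A : ℕ → Plane → ℝ := fun n => primitive 1 (φ 0 n)
  let B : ℕ → Plane → ℝ := fun n => -primitive 0 (φ 1 n)
  have hAc : ∀ n, Continuous (A n) := fun n => (hφ 0 n).continuous_primitive 1
  have hBc : ∀ n, Continuous (B n) := fun n => ((hφ 1 n).continuous_primitive 0).neg
  -- The divergences of the approximating fields tend to zero in `L¹`, so `A n` and `B n` get close.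
  have hdivlim : Tendsto (fun n => ∫⁻ y, ‖partialDeriv 0 (φ 0 n) y + partialDeriv 1 (φ 1 n) y‖ₑ)
      atTop (𝓝 0) := by
    have hup : Tendsto (fun n => (eLpNorm ((weakPartial Ω 0 fun x => u x 0) -
        partialDeriv 0 (φ 0 n)) 2 (volume.restrict Ω) + eLpNorm ((weakPartial Ω 1 fun x => u x 1) -
        partialDeriv 1 (φ 1 n)) 2 (volume.restrict Ω)) * κ) atTop (𝓝 0) := by
      simpa using ENNReal.Tendsto.mul_const ((hd 0 0).add (hd 1 1)) (Or.inr hκ)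
    refine tendsto_of_tendsto_of_tendsto_of_le_of_le tendsto_const_nhds hup (fun _ => zero_le)
      fun n => ?_
    have h0 := (hφ 0 n).isTest_partialDeriv 0
    have h1 := (hφ 1 n).isTest_partialDeriv 1
    refine (h0.add h1).lintegral_enorm_le.trans ?_
    refine mul_le_mul_left ?_ _
    refine le_trans (le_of_eq ?_) (eLpNorm_add_le (hsm 0 0 n) (hsm 1 1 n) (by norm_num))
    rw [← eLpNorm_neg]
    refine eLpNorm_congr_ae ?_
    filter_upwards [hdiv] with x hx
    rw [Fin.sum_univ_two] at hx
    simp only [Pi.neg_apply, Pi.add_apply, Pi.sub_apply]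
    linarith
  have hAB : ∀ n x, ‖A n x - B n x‖ₑ ≤
      ∫⁻ y, ‖partialDeriv 0 (φ 0 n) y + partialDeriv 1 (φ 1 n) y‖ₑ := fun n x => by
    have := enorm_primitive_add_primitive_le (hφ 0 n) (hφ 1 n) x
    simpa [A, B] using this
  have hA : UniformCauchySeqOn A atTop univ := by
    rw [Metric.uniformCauchySeqOn_iff]
    intro ε hε
    have hlim2 : Tendsto (fun n => eLpNorm ((weakPartial Ω 0 fun x => u x 0) -
        partialDeriv 0 (φ 0 n)) 2 (volume.restrict Ω) * κ) atTop (𝓝 0) := by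
      simpa using ENNReal.Tendsto.mul_const (hd 0 0) (Or.inr hκ)
    obtain ⟨N, hN⟩ := eventually_atTop.1 (hlim2.eventually_lt_const
      (ENNReal.ofReal_pos.2 (half_pos hε)))
    refine ⟨N, fun m hm n hn x _ => ?_⟩
    have h1 := enorm_primitive_le ((hφ 0 m).sub (hφ 0 n)) x
    rw [primitive_sub (hφ 0 m) (hφ 0 n)] at h1
    have h2 := (((hφ 0 m).sub (hφ 0 n)).isTest_partialDeriv 0).lintegral_enorm_le
    have h3 : eLpNorm (partialDeriv 0 (φ 0 m - φ 0 n)) 2 (volume.restrict Ω) ≤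
        eLpNorm ((weakPartial Ω 0 fun x => u x 0) - partialDeriv 0 (φ 0 n)) 2 (volume.restrict Ω) +
        eLpNorm ((weakPartial Ω 0 fun x => u x 0) -
          partialDeriv 0 (φ 0 m)) 2 (volume.restrict Ω) := by
      refine le_trans (le_of_eq ?_) (eLpNorm_sub_le (hsm 0 0 n) (hsm 0 0 m) (by norm_num))
      rw [partialDeriv_sub 0 (hφ 0 m).differentiable (hφ 0 n).differentiable,
        sub_sub_sub_cancel_left]
    have h4 : ‖A m x - A n x‖ₑ < ENNReal.ofReal ε := by
      calc _ ≤ _ := h1.trans h2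
        _ ≤ _ := mul_le_mul_left h3 _
        _ = _ := add_mul _ _ _
        _ < ENNReal.ofReal (ε / 2) + ENNReal.ofReal (ε / 2) :=
            ENNReal.add_lt_add (hN n hn) (hN m hm)
        _ = ENNReal.ofReal ε := by
            rw [← ENNReal.ofReal_add (half_pos hε).le (half_pos hε).le, add_halves]
    rw [← ofReal_norm, ENNReal.ofReal_lt_ofReal_iff hε] at h4
    rwa [dist_eq_norm]
  have hpt : ∀ x, ∃ l, Tendsto (fun n => A n x) atTop (𝓝 l) := fun x =>
    cauchySeq_tendsto_of_complete (hA.cauchySeq (mem_univ x))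
  choose ψ hψ using hpt
  have hAu : TendstoUniformly A ψ atTop :=
    tendstoUniformlyOn_univ.1 (hA.tendstoUniformlyOn_of_tendsto fun x _ => hψ x)
  have hBu : TendstoUniformly B ψ atTop := by
    rw [Metric.tendstoUniformly_iff] at hAu ⊢
    intro ε hε
    filter_upwards [hAu (ε / 2) (half_pos hε), hdivlim.eventually_lt_const
      (ENNReal.ofReal_pos.2 (half_pos hε))] with n h1 h2 x
    have h3 := (hAB n x).trans_lt h2
    rw [← ofReal_norm, ENNReal.ofReal_lt_ofReal_iff (half_pos hε), ← dist_eq_norm] at h3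
    linarith [dist_triangle (ψ x) (A n x) (B n x), h1 x]
  have hψc : Continuous ψ := hAu.continuous (Frequently.of_forall hAc)
  -- One of `A n x` and `B n x` vanishes as soon as `x` has a large coordinate.
  have hinf : Tendsto ψ (cocompact Plane) (𝓝 0) := by
    rw [Metric.tendsto_nhds]
    intro ε hε
    obtain ⟨n, h1, h2⟩ := ((Metric.tendstoUniformly_iff.1 hAu ε hε).and
      (Metric.tendstoUniformly_iff.1 hBu ε hε)).exists
    obtain ⟨R₀, hR₀⟩ := (hφ 0 n).exists_radius
    obtain ⟨R₁, hR₁⟩ := (hφ 1 n).exists_radius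
    rw [← Metric.cobounded_eq_cocompact]
    filter_upwards [(tendsto_norm_cobounded_atTop (E := Plane)).eventually_gt_atTop
      (|R₀| + |R₁|)] with x hx
    have hx2 : R₀ < |x 0| ∨ R₁ < |x 1| := by
      by_contra! hle
      have h3 : ‖x‖ ^ 2 ≤ (|x 0| + |x 1|) ^ 2 := by
        rw [EuclideanSpace.norm_sq_eq, Fin.sum_univ_two, Real.norm_eq_abs, Real.norm_eq_abs]
        nlinarith [abs_nonneg (x 0), abs_nonneg (x 1)]
      have h4 := abs_le_of_sq_le_sq' h3 (by positivity)
      linarith [h4.2, le_abs_self R₀, le_abs_self R₁]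
    rcases hx2 with hx2 | hx2
    · have : A n x = 0 := setIntegral_eq_zero_of_forall_eq_zero fun s _ =>
        hR₀ _ 0 (by rwa [coordLine_apply_of_ne (by decide)])
      rw [← this]; exact h1 x
    · have : B n x = 0 := neg_eq_zero.2 (setIntegral_eq_zero_of_forall_eq_zero fun s _ =>
        hR₁ _ 1 (by rwa [coordLine_apply_of_ne (by decide)]))
      rw [← this]; exact h2 x
  have hloc : ∀ x ∉ closure Ω, ∀ᶠ y in 𝓝 x, ψ y = ψ x := fun p hp => by
    obtain ⟨r, hr, hball⟩ := Metric.isOpen_iff.1 isClosed_closure.isOpen_compl p hp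
    have hout : ∀ j n, ∀ z ∈ Metric.ball p r, φ j n z = 0 := fun j n z hz =>
      (hφ j n).eq_zero fun h => hball hz (subset_closure h)
    filter_upwards [Metric.ball_mem_nhds p hr] with y hy
    -- Join `p` to `y` by a horizontal and a vertical segment inside the ball.
    have hnear : ∀ s ∈ uIcc (p 0) (y 0), coordLine 0 p s ∈ Metric.ball p r := fun s hs => by
      rw [mem_ball_iff_norm] at hy ⊢
      have h1 : |s - p 0| ≤ |y 0 - p 0| := abs_sub_left_of_mem_uIcc hs
      have h2 : ‖coordLine 0 p s - p‖ = |s - p 0| := by simp [coordLine, norm_smul]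
      rw [h2]
      exact (h1.trans (abs_apply_le_norm (y - p) 0)).trans_lt hy
    have hy' : coordLine 1 (coordLine 0 p (y 0)) (y 1) = y := by
      ext k
      fin_cases k <;> simp [coordLine]
    have hmid := hnear _ right_mem_uIcc
    have hnear2 : ∀ s ∈ uIcc (coordLine 0 p (y 0) 1) (y 1),
        coordLine 1 (coordLine 0 p (y 0)) s ∈ Metric.ball p r := fun s hs => by
      have hseg : coordLine 1 (coordLine 0 p (y 0)) s ∈ segment ℝ (coordLine 0 p (y 0)) y := by
        rw [← segment_eq_uIcc] at hs
        obtain ⟨a, b, ha, hb, hab, rfl⟩ := hs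
        refine ⟨a, b, ha, hb, hab, ?_⟩
        ext k
        fin_cases k
        · simp [coordLine]
          linear_combination (y 0) * hab
        · simp [coordLine]
      exact (convex_ball p r).segment_subset hmid hy hseg
    have hB0 : ∀ n, B n (coordLine 0 p (y 0)) = B n p := fun n => by
      have h1 := (hφ 1 n).primitive_sub_primitive 0 p (y 0)
      rw [intervalIntegral.integral_congr (g := fun _ => 0) fun s hs => hout 1 n _ (hnear s hs),
        intervalIntegral.integral_zero] at h1
      simp only [B, Pi.neg_apply]
      linarith
    have hA0 : ∀ n, A n y = A n (coordLine 0 p (y 0)) := fun n => by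
      have h1 := (hφ 0 n).primitive_sub_primitive 1 (coordLine 0 p (y 0)) (y 1)
      rw [intervalIntegral.integral_congr (g := fun _ => 0) fun s hs => hout 0 n _ (hnear2 s hs),
        intervalIntegral.integral_zero, hy'] at h1
      simp only [A]
      linarith
    have e1 : ψ y = ψ (coordLine 0 p (y 0)) :=
      tendsto_nhds_unique (hAu.tendsto_at y) ((hAu.tendsto_at _).congr fun n => (hA0 n).symm)
    have e2 : ψ (coordLine 0 p (y 0)) = ψ p :=
      tendsto_nhds_unique (hBu.tendsto_at _) ((hBu.tendsto_at p).congr fun n => (hB0 n).symm)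
    exact e1.trans e2
  have hind : ∀ j, LocallyIntegrableOn (Ω.indicator fun x => u x j) univ := fun j =>
    ((hu j).hasWeakPartial_indicator hΩ 0).1
  have hintlim : ∀ j {θ : Plane → ℝ}, IsTest univ θ →
      Tendsto (fun n => ∫ x, φ j n x * θ x) atTop
        (𝓝 (∫ x, Ω.indicator (fun x => u x j) x * θ x)) := fun j θ hθ => by
    have h1 := tendsto_integral_mul_of_tendsto_eLpNorm (hθ.memLp 2 _)
      (fun n => (hφ j n).memLp 2 _) (hu j).1.memLp (tendsto_eLpNorm_of_normSqH (hlim j))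
    have h2 : ∫ x, Ω.indicator (fun x => u x j) x * θ x = ∫ x in Ω, θ x * u x j := by
      rw [← integral_indicator hΩ.measurableSet]
      refine integral_congr_ae (Eventually.of_forall fun x => ?_)
      by_cases hx : x ∈ Ω <;> simp [hx, mul_comm]
    rw [h2]
    refine h1.congr fun n => ?_
    rw [(hφ j n).setIntegral_mul]
    simp_rw [mul_comm]
  refine ⟨ψ, hψc, hinf, hloc, ?_, ?_⟩
  · rw [hasWeakPartial_iff]
    refine ⟨hψc.locallyIntegrable.locallyIntegrableOn _, hind 0, fun θ hθ => ?_⟩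
    refine tendsto_nhds_unique (tendsto_integral_mul_of_tendstoUniformly hAc hAu
      (hθ.isTest_partialDeriv 1)) ((hintlim 0 hθ).neg.congr fun n => ?_)
    rw [(hφ 0 n).integral_primitive_mul hθ]
  · rw [hasWeakPartial_iff]
    refine ⟨hψc.locallyIntegrable.locallyIntegrableOn _, (hind 1).neg, fun θ hθ => ?_⟩
    simp only [Pi.neg_apply, neg_mul, integral_neg, neg_neg]
    refine tendsto_nhds_unique (tendsto_integral_mul_of_tendstoUniformly hBc hBu
      (hθ.isTest_partialDeriv 0)) ((hintlim 1 hθ).congr fun n => ?_)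
    simp only [B, Pi.neg_apply, neg_mul, integral_neg]
    rw [(hφ 1 n).integral_primitive_mul hθ, neg_neg]

/-- A continuous function on the plane vanishing at infinity, which is locally constant on the
complement of a simply connected open set, vanishes on this complement: its nonzero level sets there
would be compact pieces of the complement. -/
lemma eq_zero_of_locally_constant (hΩ : IsOpen Ω) (hsc : IsSimplyConnected Ω) {ψ : Plane → ℝ}
    (hψ : Continuous ψ) (hinf : Tendsto ψ (cocompact Plane) (𝓝 0))
    (hloc : ∀ p ∉ Ω, ∀ᶠ y in 𝓝 p, y ∉ Ω → ψ y = ψ p) {p : Plane} (hp : p ∉ Ω) : ψ p = 0 := by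
  by_contra h0
  let A : Set Plane := {x | x ∉ Ω ∧ ψ x = ψ p}
  let B : Set Plane := {x | x ∉ Ω ∧ ψ x ≠ ψ p}
  have hAc : IsClosed A := hΩ.isClosed_compl.inter (isClosed_eq hψ continuous_const)
  have hA : IsCompact A := by
    have h1 : ∀ᶠ x in cocompact Plane, ψ x ≠ ψ p :=
      hinf.eventually_ne (fun h => h0 h.symm)
    obtain ⟨K, hK, hKs⟩ := mem_cocompact.1 h1
    refine hK.of_isClosed_subset hAc fun x hx => ?_
    by_contra hxK
    exact hKs hxK hx.2
  have hB : IsClosed B := by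
    rw [← isOpen_compl_iff, isOpen_iff_mem_nhds]
    intro x hx
    by_cases hxΩ : x ∈ Ω
    · filter_upwards [hΩ.mem_nhds hxΩ] with y hy h using h.1 hy
    · have hx2 : ψ x = ψ p := by
        by_contra hne
        exact hx ⟨hxΩ, hne⟩
      filter_upwards [hloc x hxΩ] with y hy h using h.2 ((hy h.1).trans hx2)
  have hempty := eq_empty_of_isCompact_of_compl hΩ hsc hA hB
    (disjoint_left.2 fun x hx hx' => hx'.2 hx.2) (by
      ext x
      simp only [A, B, mem_union, mem_ofPred_eq, mem_compl_iff]
      tauto)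
  have : p ∈ A := ⟨hp, rfl⟩
  rw [hempty] at this
  exact this

/-- On a simply connected Lipschitz open set of finite area, every divergence free `H¹_0` field has
a stream function in `H²_0`. -/
lemma exists_stream_function_memH0 (hΩ : IsLipschitzOpen Ω) (harea : volume Ω < ⊤)
    (hsc : IsSimplyConnected Ω) {u : Plane → Plane} (hu : MemH10Vec Ω u) (hdiv : IsDivFree Ω u) :
    ∃ ψ, MemH0 Ω 2 ψ ∧ (fun x => u x 0) =ᵐ[volume.restrict Ω] weakPartial Ω 1 ψ ∧
      (fun x => u x 1) =ᵐ[volume.restrict Ω] -weakPartial Ω 0 ψ := by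
  obtain ⟨ψ, hψc, hinf, hloc, hw1, hw0⟩ := exists_stream_function hΩ.1 harea hu hdiv
  have hzero : ∀ x ∉ Ω, ψ x = 0 := fun x hx =>
    eq_zero_of_locally_constant hΩ.1 hsc hψc hinf
      (fun p hp => hΩ.eventually_eq_of_exterior hψc hloc hp) hx
  have hfin : IsFiniteMeasure (volume.restrict Ω) := ⟨by rwa [Measure.restrict_apply_univ]⟩
  obtain ⟨C, hC⟩ : ∃ C, ∀ x, ‖ψ x‖ ≤ C := by
    obtain ⟨K, hK, hKs⟩ := mem_cocompact.1 (hinf.norm.eventually_lt_const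
      (show ‖(0 : ℝ)‖ < 1 by simp))
    obtain ⟨C, hC⟩ := hK.exists_bound_of_continuousOn hψc.continuousOn
    refine ⟨max C 1, fun x => ?_⟩
    by_cases hx : x ∈ K
    · exact (hC x hx).trans (le_max_left _ _)
    · exact (hKs hx : ‖ψ x‖ < 1).le.trans (le_max_right _ _)
  have hext : ∀ {h : Plane → ℝ}, MemLp h 2 (volume.restrict Ω) →
      MemLp (Ω.indicator h) 2 (volume.restrict univ) := fun hh => by
    rw [Measure.restrict_univ]; exact (memLp_indicator_iff_restrict hΩ.1.measurableSet).2 hh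
  have hψ2 : MemLp ψ 2 (volume.restrict univ) := by
    have h1 : Ω.indicator ψ = ψ := indicator_eq_self.2 fun x hx => by
      by_contra hxΩ
      exact hx (hzero x hxΩ)
    rw [← h1]
    exact hext (MemLp.of_bound hψc.aestronglyMeasurable C (Eventually.of_forall hC))
  have hu1 : ∀ j, MemH univ 1 (Ω.indicator fun x => u x j) := fun j =>
    (memH_succ_iff (k := 0) isOpen_univ fun i => (hu j).hasWeakPartial_indicator hΩ.1 i).2
      ⟨hext (hu j).1.memLp, fun i => hext ((hu j).1.2 i).2⟩
  have hψH : MemH univ 2 ψ := by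
    refine (memH_succ_iff (k := 1) isOpen_univ
      (w := ![-Ω.indicator fun x => u x 1, Ω.indicator fun x => u x 0]) fun i => ?_).2
      ⟨hψ2, fun i => ?_⟩
    · fin_cases i
      · exact hw0
      · exact hw1
    · fin_cases i
      · exact (hu1 1).neg isOpen_univ
      · exact hu1 0
  refine ⟨ψ, hΩ.memH0_of_eq_zero hψH hzero, ?_, ?_⟩
  · have h1 := (hw1.mono (subset_univ Ω)).weakPartial_ae_eq hΩ.1
    exact (h1.trans (indicator_ae_eq_restrict hΩ.1.measurableSet)).symm
  · have h1 := (hw0.mono (subset_univ Ω)).weakPartial_ae_eq hΩ.1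
    filter_upwards [h1, indicator_ae_eq_restrict (f := fun x => u x 1)
      (μ := volume) hΩ.1.measurableSet] with x a b
    rw [Pi.neg_apply, a, Pi.neg_apply, b, neg_neg]

end BucklingStokes

end

theorem proposition3p1 (Ω : Set BucklingStokes.Plane) (hne : Ω.Nonempty)
    (hΩ : BucklingStokes.IsLipschitzOpen Ω) (harea : MeasureTheory.volume Ω < ⊤) :
    BucklingStokes.lambdaS Ω ≤ BucklingStokes.lambdaB Ω ∧
      (IsSimplyConnected Ω → BucklingStokes.lambdaB Ω = BucklingStokes.lambdaS Ω) := by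
  have hle := BucklingStokes.lambdaS_le_lambdaB hΩ.1 hne
  refine ⟨hle, fun hsc => ?_⟩
  unfold BucklingStokes.lambdaB BucklingStokes.lambdaS
  congr 1
  ext q
  constructor
  · rintro ⟨ψ, h, h0, rfl⟩
    obtain ⟨u, hu, hdiv, e1, e2⟩ := h.exists_velocity hΩ.1
    exact ⟨u, hu, hdiv, by rwa [e2], by rw [e1, e2]⟩
  · rintro ⟨u, hu, hdiv, h0, rfl⟩
    obtain ⟨ψ, hψ, h1, h2⟩ :=
      BucklingStokes.exists_stream_function_memH0 hΩ harea hsc hu hdiv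
    obtain ⟨e1, e2⟩ := BucklingStokes.energies_eq hΩ.1 hψ h1 h2
    exact ⟨ψ, hψ, by rwa [← e2], by rw [e1, e2]⟩
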